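/- **Setting.** Fix an alphabet $\Sigma$ and an infinite set $\mathbb X$ of string variables. A string term is a nonempty concatenation of variables. A string formula is a Boolean combination of relational constraints $R(t,t')$ ($t,t'$ string terms, $R$ the equality or a transducer over $\Sigma$, i.e. a finite automaton over $(\Sigma\cup\{\epsilon\})^2$), membership constraints $t\in L(\mathcal A)$ ($\mathcal A$ a finite automaton) and inequalities between linear functions of term lengths $|t|$, where a relational constraint may occur negatively only if its relation is invertible, i.e. the complement of the relation is again recognised by a transducer (or is equality). It is interpreted by maps $\eta:\mathbb X\to\Sigma^*$ and is satisfiable if some $\eta$ makes it true. Its DNF is the usual one, where negated relational constraints are eliminated by complementing the relation; a clause is thus a conjunction of (positive) relational constraints and possibly negated membership and arithmetic constraints. The *splitting graph* of a conjunction of relational constraints has as nodes the positions, i.e. the occurrences of variables in the two sides of the constraints; there is an edge $(p,p')$ iff there is a position $p''\neq p'$ on the other side of the constraint of $p$ that carries the same variable as $p'$. A *chain* is a nonempty closed sequence of edges $(p_0,p_1),\dots,(p_n,p_0)$. A formula is *chain-free* if the splitting graph of (the relational constraints of) each clause of its DNF has no chain. It is *concatenation-free* if both sides of each relational constraint are single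 variables. **Splitting step.** Let $C=\varphi\wedge\Psi$ be a clause where $\varphi=R(x\circ t,\,y\circ t')$ is not concatenation-free, and let $x_1,x_2,y_1,y_2$ be fresh variables. The step replaces $C$ by the clauses $$\bigl(R_i(x_1,y)\wedge R_i'(x_2\circ t,t')\wedge\Psi\bigr)[x/x_1\circ x_2]\;\wedge\;|x|=|x_1|+|x_2|$$ (omitted if $t'=\epsilon$) and $$\bigl(R_i(x,y_1)\wedge R_i'(t,y_2\circ t')\wedge\Psi\bigr)[y/y_1\circ y_2]\;\wedge\;|y|=|y_1|+|y_2|$$ (omitted if $t=\epsilon$). Here $(R_i,R_i')$ ranges over the single pair $({=},{=})$ if $R$ is the equality, and over the pairs $(\mathcal T_q,{}_q\mathcal T)$, $q$ a state of $\mathcal T$, if $R$ is a transducer $\mathcal T$, where $\mathcal T_q$ (resp. ${}_q\mathcal T$) is $\mathcal T$ with the set of final (resp. initial) states replaced by $\{q\}$. The *successors* of a constraint of $\Psi$ are its images under the substitution; the successors of $\varphi$ are the two displayed constraints. **Splitting algorithm** (nondeterministic, run on the DNF of a formula). *Phase 1* keeps with each clause a *reminder*, a subset of its relational constraints. A *root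 constraint* of a reminder is a constraint of it for which all positions on one of its sides have no incoming edge in the splitting graph of the reminder. The initial reminder is the set of all relational constraints of the clause, from which concatenation-free root constraints are removed repeatedly until there are none left. A splitting step may be applied in Phase 1 only to a root constraint of the reminder of a clause; the reminder of each resulting clause consists of the successors of the constraints of the old reminder, from which again concatenation-free root constraints are removed until there are none left. Phase 1 ends when all reminders are concatenation-free (possibly empty). *Phase 2* then performs splitting steps, in any order, until all relational constraints are concatenation-free. **Theorem.** Let $\Psi$ be a chain-free string formula. Then the splitting algorithm run on $\Psi$ terminates: it has no infinite run, and every run that cannot be continued has ended in Phase 2 with a formula in DNF that is satisfiable if and only if $\Psi$ is, is chain-free, and is concatenation-free, i.e. all its relational constraints are between single variables. -/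

import Mathlib

namespace StringConstraints

universe u v

/-! ## Finite automata and transducers -/

/-- A finite automaton (with `ε`-transitions) over the letters `A`. -/
structure Automaton (A : Type u) where
  Q : Type
  [finQ : Fintype Q]
  nfa : εNFA A Q

attribute [instance] Automaton.finQ

/-- A transducer: a two-tape automaton, i.e. an automaton over pairs of letters of `Σ ∪ {ε}`
(`none` is `ε`). -/
abbrev Transducer (α : Type u) := Automaton (Option α × Option α)

/-- The relation on words recognised by a transducer. -/
def Transducer.relation {α : Type u} (T : Transducer α) : Set (List α × List α) :=
  {p | ∃ w ∈ T.nfa.accepts, p.1 = w.filterMap Prod.fst ∧ p.2 = w.filterMap Prod.snd}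

/-- `T` with its set of final states replaced by `{q}`. -/
def Transducer.stopAt {α : Type u} (T : Transducer α) (q : T.Q) : Transducer α where
  Q := T.Q
  nfa := { step := T.nfa.step, start := T.nfa.start, accept := {q} }

/-- `T` with its set of initial states replaced by `{q}`. -/
def Transducer.startAt {α : Type u} (T : Transducer α) (q : T.Q) : Transducer α where
  Q := T.Q
  nfa := { step := T.nfa.step, start := {q}, accept := T.nfa.accept }

/-! ## Syntax and semantics of string formulae -/

/-- A string term: a (nonempty) concatenation of variables. -/
structure StrTerm (V : Type v) where
  head : V
  tail : List V

/-- The sequence of variables of a term. -/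
def StrTerm.toList {V : Type v} (t : StrTerm V) : List V := t.head :: t.tail

/-- A single variable, as a term. -/
def StrTerm.var {V : Type v} (x : V) : StrTerm V := ⟨x, []⟩

/-- The value of a term under an interpretation. -/
def StrTerm.eval {α : Type u} {V : Type v} (η : V → List α) (t : StrTerm V) : List α :=
  t.toList.flatMap η

/-- Replace every occurrence of `x` by `x₁ ∘ x₂` in a sequence of variables. -/
def substVars {V : Type v} [DecidableEq V] (x x₁ x₂ : V) (l : List V) : List V :=
  l.flatMap fun z => if z = x then [x₁, x₂] else [z]

/-- `t[x / x₁ ∘ x₂]`. -/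
def StrTerm.subst {V : Type v} [DecidableEq V] (x x₁ x₂ : V) (t : StrTerm V) : StrTerm V :=
  if t.head = x then ⟨x₁, x₂ :: substVars x x₁ x₂ t.tail⟩
  else ⟨t.head, substVars x x₁ x₂ t.tail⟩

/-- The predicate of a relational constraint: equality, or a transducer. -/
inductive RelSym (α : Type u) where
  | eq : RelSym α
  | trans : Transducer α → RelSym α

/-- The relation on words denoted by a predicate. -/
def RelSym.relation {α : Type u} : RelSym α → Set (List α × List α)
  | .eq => {p | p.1 = p.2}
  | .trans T => T.relation

/-- A predicate is invertible if its negation can be eliminated: the complementary relation is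
again the relation of some predicate. -/
def RelSym.Invertible {α : Type u} (R : RelSym α) : Prop :=
  ∃ R' : RelSym α, R'.relation = R.relationᶜ

open Classical in
/-- A predicate for the complementary relation, when `R` is invertible. -/
noncomputable def RelSym.compl {α : Type u} (R : RelSym α) : RelSym α :=
  if h : R.Invertible then h.choose else R

/-- A relational constraint `R(t, t')`. -/
structure RelConstraint (α : Type u) (V : Type v) where
  rel : RelSym α
  lhs : StrTerm V
  rhs : StrTerm V

namespace RelConstraint
variable {α : Type u} {V : Type v}

def Holds (η : V → List α) (φ : RelConstraint α V) : Prop :=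
  (φ.lhs.eval η, φ.rhs.eval η) ∈ φ.rel.relation

def vars (φ : RelConstraint α V) : List V := φ.lhs.toList ++ φ.rhs.toList

def subst [DecidableEq V] (x x₁ x₂ : V) (φ : RelConstraint α V) : RelConstraint α V :=
  ⟨φ.rel, φ.lhs.subst x x₁ x₂, φ.rhs.subst x x₁ x₂⟩

/-- Both sides are single variables. -/
def ConcatFree (φ : RelConstraint α V) : Prop := φ.lhs.tail = [] ∧ φ.rhs.tail = []

end RelConstraint

/-- Arithmetic terms: linear functions over lengths of string terms. -/
inductive ArithTerm (V : Type v) where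
  | const : ℤ → ArithTerm V
  | len : StrTerm V → ArithTerm V
  | add : ArithTerm V → ArithTerm V → ArithTerm V
  | smul : ℤ → ArithTerm V → ArithTerm V

namespace ArithTerm
variable {α : Type u} {V : Type v}

def eval (η : V → List α) : ArithTerm V → ℤ
  | const k => k
  | len t => ((t.eval η).length : ℤ)
  | add a b => a.eval η + b.eval η
  | smul k a => k * a.eval η

def vars : ArithTerm V → List V
  | const _ => []
  | len t => t.toList
  | add a b => a.vars ++ b.vars
  | smul _ a => a.vars

def subst [DecidableEq V] (x x₁ x₂ : V) : ArithTerm V → ArithTerm V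
  | const k => const k
  | len t => len (t.subst x x₁ x₂)
  | add a b => add (a.subst x x₁ x₂) (b.subst x x₁ x₂)
  | smul k a => smul k (a.subst x x₁ x₂)

end ArithTerm

/-- The atomic constraints other than relational ones: memberships and inequalities of
arithmetic terms. -/
inductive SideAtom (α : Type u) (V : Type v) where
  | mem : StrTerm V → Automaton α → SideAtom α V
  | le : ArithTerm V → ArithTerm V → SideAtom α V

namespace SideAtom
variable {α : Type u} {V : Type v}

def Holds (η : V → List α) : SideAtom α V → Prop
  | mem t A => t.eval η ∈ A.nfa.accepts
  | le a b => a.eval η ≤ b.eval η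

def vars : SideAtom α V → List V
  | mem t _ => t.toList
  | le a b => a.vars ++ b.vars

def subst [DecidableEq V] (x x₁ x₂ : V) : SideAtom α V → SideAtom α V
  | mem t A => mem (t.subst x x₁ x₂) A
  | le a b => le (a.subst x x₁ x₂) (b.subst x x₁ x₂)

end SideAtom

/-- A possibly negated membership or arithmetic constraint (negated when `pos = false`). -/
structure SideLiteral (α : Type u) (V : Type v) where
  pos : Bool
  atom : SideAtom α V

namespace SideLiteral
variable {α : Type u} {V : Type v}

def Holds (η : V → List α) (l : SideLiteral α V) : Prop :=
  if l.pos then l.atom.Holds η else ¬ l.atom.Holds η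

def subst [DecidableEq V] (x x₁ x₂ : V) (l : SideLiteral α V) : SideLiteral α V :=
  ⟨l.pos, l.atom.subst x x₁ x₂⟩

end SideLiteral

/-- A clause: the conjunction of a list of relational constraints and a list of membership and
arithmetic literals. -/
structure Clause (α : Type u) (V : Type v) where
  rels : List (RelConstraint α V)
  side : List (SideLiteral α V)

namespace Clause
variable {α : Type u} {V : Type v}

def Holds (η : V → List α) (C : Clause α V) : Prop :=
  (∀ φ ∈ C.rels, φ.Holds η) ∧ ∀ l ∈ C.side, l.Holds η

def vars (C : Clause α V) : List V :=
  C.rels.flatMap RelConstraint.vars ++ C.side.flatMap fun l => l.atom.vars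

/-- Conjunction of two clauses. -/
def conj (C D : Clause α V) : Clause α V := ⟨C.rels ++ D.rels, C.side ++ D.side⟩

end Clause

/-- A formula in disjunctive normal form: the disjunction of a list of clauses. -/
abbrev DNF (α : Type u) (V : Type v) := List (Clause α V)

def DNF.Satisfiable {α : Type u} {V : Type v} (D : DNF α V) : Prop :=
  ∃ η : V → List α, ∃ C ∈ D, C.Holds η

/-- String formulae: Boolean combinations of relational, membership and arithmetic
constraints. -/
inductive StringFormula (α : Type u) (V : Type v) where
  | rel : RelConstraint α V → StringFormula α V
  | side : SideAtom α V → StringFormula α V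
  | neg : StringFormula α V → StringFormula α V
  | and : StringFormula α V → StringFormula α V → StringFormula α V
  | or : StringFormula α V → StringFormula α V → StringFormula α V

namespace StringFormula
variable {α : Type u} {V : Type v}

def Holds (η : V → List α) : StringFormula α V → Prop
  | rel φ => φ.Holds η
  | side a => a.Holds η
  | neg Ψ => ¬ Ψ.Holds η
  | and Ψ Θ => Ψ.Holds η ∧ Θ.Holds η
  | or Ψ Θ => Ψ.Holds η ∨ Θ.Holds η

def Satisfiable (Ψ : StringFormula α V) : Prop := ∃ η : V → List α, Ψ.Holds η

/-- With `pol = true`: the predicates of all relational constraints occurring negatively in `Ψ`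
(under an odd number of negations) are invertible; with `pol = false`: the same for the
positive occurrences. -/
def NegativesInvertible : Bool → StringFormula α V → Prop
  | pol, rel φ => pol = false → φ.rel.Invertible
  | _, side _ => True
  | pol, neg Ψ => Ψ.NegativesInvertible (!pol)
  | pol, and Ψ Θ => Ψ.NegativesInvertible pol ∧ Θ.NegativesInvertible pol
  | pol, or Ψ Θ => Ψ.NegativesInvertible pol ∧ Θ.NegativesInvertible pol

/-- The restriction on negation in string formulae: constraints that are not invertible have
only positive occurrences. -/
def WellFormed (Ψ : StringFormula α V) : Prop := Ψ.NegativesInvertible true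

/-- The disjunctive normal form of `Ψ` (`pol = true`) or of its negation (`pol = false`).
Negated relational constraints are eliminated by complementing their predicate. -/
noncomputable def dnfAux : Bool → StringFormula α V → DNF α V
  | true, rel φ => [⟨[φ], []⟩]
  | false, rel φ => [⟨[⟨φ.rel.compl, φ.lhs, φ.rhs⟩], []⟩]
  | pol, side a => [⟨[], [⟨pol, a⟩]⟩]
  | pol, neg Ψ => Ψ.dnfAux (!pol)
  | true, and Ψ Θ => (Ψ.dnfAux true).flatMap fun C => (Θ.dnfAux true).map fun D => C.conj D
  | false, and Ψ Θ => Ψ.dnfAux false ++ Θ.dnfAux false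
  | true, or Ψ Θ => Ψ.dnfAux true ++ Θ.dnfAux true
  | false, or Ψ Θ => (Ψ.dnfAux false).flatMap fun C => (Θ.dnfAux false).map fun D => C.conj D

/-- The disjunctive normal form of a string formula. -/
noncomputable def dnf (Ψ : StringFormula α V) : DNF α V := Ψ.dnfAux true

end StringFormula

/-! ## The splitting graph -/

inductive Side where
  | left
  | right
  deriving DecidableEq

/-- The term on a given side of a constraint. -/
def RelConstraint.term {α : Type u} {V : Type v} (φ : RelConstraint α V) : Side → StrTerm V
  | .left => φ.lhs
  | .right => φ.rhs

/-- Candidate positions in a conjunction of relational constraints: the `idx`-th variable on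
side `side` of the `con`-th constraint (counting from zero). -/
@[ext] structure Position where
  con : ℕ
  side : Side
  idx : ℕ

section SplittingGraph
variable {α : Type u} {V : Type v}

/-- The variable labelling a position; `none` if there is no such position. -/
def label (Γ : List (RelConstraint α V)) (p : Position) : Option V :=
  Γ[p.con]?.bind fun φ => (φ.term p.side).toList[p.idx]?

/-- `p` is a position of (the splitting graph of) the conjunction `Γ`. -/
def IsPosition (Γ : List (RelConstraint α V)) (p : Position) : Prop := (label Γ p).isSome

/-- `p` and `q` lie on different sides of the same constraint. -/
def Opposing (p q : Position) : Prop := p.con = q.con ∧ p.side ≠ q.side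

/-- The edges of the splitting graph of the conjunction `Γ`. -/
def Edge (Γ : List (RelConstraint α V)) (p p' : Position) : Prop :=
  IsPosition Γ p ∧ IsPosition Γ p' ∧
    ∃ p'', IsPosition Γ p'' ∧ p'' ≠ p' ∧ Opposing p p'' ∧ label Γ p'' = label Γ p'

/-- There is no chain, that is, no nonempty closed sequence of edges
`(p₀, p₁), (p₁, p₂), …, (pₙ, p₀)`. -/
def GraphChainFree (Γ : List (RelConstraint α V)) : Prop :=
  ∀ p, ¬ Relation.TransGen (Edge Γ) p p

/-- Root nodes: positions without incoming edges. -/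
def IsRootNode (Γ : List (RelConstraint α V)) (p : Position) : Prop :=
  IsPosition Γ p ∧ ∀ q, ¬ Edge Γ q p

/-- The `j`-th constraint of `Γ` is a root constraint: all positions at one of its sides are
root nodes. -/
def IsRootConstraint (Γ : List (RelConstraint α V)) (j : ℕ) : Prop :=
  j < Γ.length ∧ ∃ s : Side, ∀ p, IsPosition Γ p → p.con = j → p.side = s → IsRootNode Γ p

/-- A DNF is chain-free if the splitting graph of each of its clauses is. -/
def DNF.ChainFree (D : DNF α V) : Prop := ∀ C ∈ D, GraphChainFree C.rels

/-- A string formula is chain-free if its DNF is. -/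
def StringFormula.ChainFree (Ψ : StringFormula α V) : Prop := DNF.ChainFree Ψ.dnf

/-- All relational constraints relate single variables. -/
def DNF.ConcatFree (D : DNF α V) : Prop := ∀ C ∈ D, ∀ φ ∈ C.rels, φ.ConcatFree

end SplittingGraph

/-! ## The split of a constraint -/

/-- The pairs of predicates used in the disjuncts of a split: `(=, =)` for an equality, and
`(T_q, _qT)` for each state `q` of a transducer `T`. -/
noncomputable def RelSym.splits {α : Type u} : RelSym α → List (RelSym α × RelSym α)
  | .eq => [(.eq, .eq)]
  | .trans T => (Finset.univ : Finset T.Q).toList.map fun q =>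
      (.trans (T.stopAt q), .trans (T.startAt q))

/-- A disjunct of a split: the two constraints that replace the split constraint, and the
substitution `[x / x₁ ∘ x₂]` that goes with it. -/
structure SplitCase (α : Type u) (V : Type v) where
  x : V
  x₁ : V
  x₂ : V
  fst : RelConstraint α V
  snd : RelConstraint α V

namespace RelConstraint
variable {α : Type u} {V : Type v} [DecidableEq V]

/-- The left split of `R(x ∘ t, y ∘ t')`: the disjuncts
`(Rᵢ(x₁, y) ∧ Rᵢ'(x₂ ∘ t, t'))[x / x₁ ∘ x₂]`; it is left out if `t'` is empty. -/
noncomputable def leftSplit (φ : RelConstraint α V) (x₁ x₂ : V) : List (SplitCase α V) :=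
  match φ.rhs.tail with
  | [] => []
  | b :: l => φ.rel.splits.map fun R =>
      { x := φ.lhs.head, x₁ := x₁, x₂ := x₂
        fst := subst φ.lhs.head x₁ x₂ ⟨R.1, .var x₁, .var φ.rhs.head⟩
        snd := subst φ.lhs.head x₁ x₂ ⟨R.2, ⟨x₂, φ.lhs.tail⟩, ⟨b, l⟩⟩ }

/-- The right split of `R(x ∘ t, y ∘ t')`: the disjuncts
`(Rⱼ(x, y₁) ∧ Rⱼ'(t, y₂ ∘ t'))[y / y₁ ∘ y₂]`; it is left out if `t` is empty. -/
noncomputable def rightSplit (φ : RelConstraint α V) (y₁ y₂ : V) : List (SplitCase α V) :=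
  match φ.lhs.tail with
  | [] => []
  | a :: l => φ.rel.splits.map fun R =>
      { x := φ.rhs.head, x₁ := y₁, x₂ := y₂
        fst := subst φ.rhs.head y₁ y₂ ⟨R.1, .var φ.lhs.head, .var y₁⟩
        snd := subst φ.rhs.head y₁ y₂ ⟨R.2, ⟨a, l⟩, ⟨y₂, φ.rhs.tail⟩⟩ }

/-- All disjuncts of the split of a constraint. -/
noncomputable def split (φ : RelConstraint α V) (x₁ x₂ y₁ y₂ : V) : List (SplitCase α V) :=
  φ.leftSplit x₁ x₂ ++ φ.rightSplit y₁ y₂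

end RelConstraint

/-- The length constraint `|x| = |x₁| + |x₂|`, as two inequalities. -/
def lengthConstraint {α : Type u} {V : Type v} (x x₁ x₂ : V) : List (SideLiteral α V) :=
  [⟨true, .le (.len (.var x)) (.add (.len (.var x₁)) (.len (.var x₂)))⟩,
   ⟨true, .le (.add (.len (.var x₁)) (.len (.var x₂))) (.len (.var x))⟩]

/-- The membership and arithmetic constraints of a clause after a splitting step. -/
def SplitCase.newSide {α : Type u} {V : Type v} [DecidableEq V] (c : SplitCase α V)
    (side : List (SideLiteral α V)) : List (SideLiteral α V) :=
  side.map (SideLiteral.subst c.x c.x₁ c.x₂) ++ lengthConstraint c.x c.x₁ c.x₂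

/-- The relational constraints resulting from splitting `φ` in `Γ₁ ∧ φ ∧ Γ₂`. -/
def SplitCase.newRels {α : Type u} {V : Type v} [DecidableEq V] (c : SplitCase α V)
    (Γ₁ Γ₂ : List (RelConstraint α V)) : List (RelConstraint α V) :=
  Γ₁.map (RelConstraint.subst c.x c.x₁ c.x₂) ++ c.fst :: c.snd ::
    Γ₂.map (RelConstraint.subst c.x c.x₁ c.x₂)

/-- The variables `x₁, x₂, y₁, y₂` are pairwise different and do not occur in `C`. -/
def FreshFor {α : Type u} {V : Type v} (C : Clause α V) (x₁ x₂ y₁ y₂ : V) : Prop :=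
  [x₁, x₂, y₁, y₂].Nodup ∧ ∀ z ∈ [x₁, x₂, y₁, y₂], z ∉ C.vars

/-! ## The splitting algorithm -/

/-- A clause whose relational constraints are divided into its reminder and the constraints that
do not belong to the reminder. -/
structure AnnClause (α : Type u) (V : Type v) where
  reminder : List (RelConstraint α V)
  dropped : List (RelConstraint α V)
  side : List (SideLiteral α V)

namespace AnnClause
variable {α : Type u} {V : Type v}

/-- The underlying clause. -/
def toClause (a : AnnClause α V) : Clause α V := ⟨a.reminder ++ a.dropped, a.side⟩

/-- A clause whose reminder consists of all its relational constraints. -/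
def ofClause (C : Clause α V) : AnnClause α V := ⟨C.rels, [], C.side⟩

/-- Remove one concatenation-free root constraint from the reminder. -/
inductive DropStep : AnnClause α V → AnnClause α V → Prop
  | drop (Γ₁ : List (RelConstraint α V)) (φ : RelConstraint α V)
      (Γ₂ Δ : List (RelConstraint α V)) (side : List (SideLiteral α V))
      (hroot : IsRootConstraint (Γ₁ ++ φ :: Γ₂) Γ₁.length) (hφ : φ.ConcatFree) :
      DropStep ⟨Γ₁ ++ φ :: Γ₂, Δ, side⟩ ⟨Γ₁ ++ Γ₂, φ :: Δ, side⟩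

/-- `b` is obtained from `a` by removing concatenation-free root constraints from the reminder
until there are none left. -/
def DropsTo (a b : AnnClause α V) : Prop :=
  Relation.ReflTransGen DropStep a b ∧ ∀ c, ¬ DropStep b c

/-- The clause obtained from `a`, whose reminder is `Γ₁ ∧ φ ∧ Γ₂`, by a disjunct of the split of
`φ`; its reminder consists of the successors of the constraints of the reminder of `a`. -/
def splitChild [DecidableEq V] (a : AnnClause α V) (Γ₁ Γ₂ : List (RelConstraint α V))
    (c : SplitCase α V) : AnnClause α V :=
  ⟨c.newRels Γ₁ Γ₂, a.dropped.map (RelConstraint.subst c.x c.x₁ c.x₂), c.newSide a.side⟩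

/-- The reminder is concatenation-free (possibly empty). -/
def ReminderConcatFree (a : AnnClause α V) : Prop := ∀ φ ∈ a.reminder, φ.ConcatFree

end AnnClause

/-- The states of the splitting algorithm: its input, a DNF with annotated clauses in Phase 1, and
a DNF in Phase 2. -/
inductive AlgState (α : Type u) (V : Type v) where
  | input : DNF α V → AlgState α V
  | phase1 : List (AnnClause α V) → AlgState α V
  | phase2 : DNF α V → AlgState α V

/-- The steps of the (nondeterministic) splitting algorithm. -/
inductive AlgStep {α : Type u} {V : Type v} [DecidableEq V] :
    AlgState α V → AlgState α V → Prop
  /-- Compute the initial reminders. -/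
  | init (D : DNF α V) (S : List (AnnClause α V))
      (hS : List.Forall₂ AnnClause.DropsTo (D.map AnnClause.ofClause) S) :
      AlgStep (.input D) (.phase1 S)
  /-- A splitting step of Phase 1: split a root constraint `φ` of the reminder of a clause `a`
  that is not concatenation-free, and compute the new reminders. -/
  | split1 (S₁ S₂ S : List (AnnClause α V)) (a : AnnClause α V)
      (Γ₁ Γ₂ : List (RelConstraint α V)) (φ : RelConstraint α V) (x₁ x₂ y₁ y₂ : V)
      (ha : a.reminder = Γ₁ ++ φ :: Γ₂)
      (hroot : IsRootConstraint a.reminder Γ₁.length)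
      (hφ : ¬ φ.ConcatFree)
      (hfresh : FreshFor a.toClause x₁ x₂ y₁ y₂)
      (hS : List.Forall₂ AnnClause.DropsTo
        ((φ.split x₁ x₂ y₁ y₂).map (a.splitChild Γ₁ Γ₂)) S) :
      AlgStep (.phase1 (S₁ ++ a :: S₂)) (.phase1 (S₁ ++ S ++ S₂))
  /-- Phase 1 ends when the reminders of all clauses are concatenation-free. -/
  | switch (S : List (AnnClause α V)) (hS : ∀ a ∈ S, a.ReminderConcatFree) :
      AlgStep (.phase1 S) (.phase2 (S.map AnnClause.toClause))
  /-- A splitting step of Phase 2: split any constraint that is not concatenation-free. -/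
  | split2 (D₁ D₂ : DNF α V) (Γ₁ Γ₂ : List (RelConstraint α V)) (φ : RelConstraint α V)
      (side : List (SideLiteral α V)) (x₁ x₂ y₁ y₂ : V)
      (hφ : ¬ φ.ConcatFree)
      (hfresh : FreshFor ⟨Γ₁ ++ φ :: Γ₂, side⟩ x₁ x₂ y₁ y₂) :
      AlgStep (.phase2 (D₁ ++ ⟨Γ₁ ++ φ :: Γ₂, side⟩ :: D₂))
        (.phase2 (D₁ ++ (φ.split x₁ x₂ y₁ y₂).map
          (fun c => ⟨c.newRels Γ₁ Γ₂, c.newSide side⟩) ++ D₂))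

end StringConstraints

/-!
The heart of the matter is that *every* splitting step on a chain-free clause, whatever constraint
it splits, makes progress with respect to one well-founded measure.

Call a side of a constraint *ranked* by a natural number, and let the ranks be such that they
decrease along the edges of the splitting graph (the edges leaving a position depend only on the
side on which it lies). Such a ranking exists if and only if there is no chain
(`graphChainFree_iff`): if there is none, the number of positions reachable from a side will do. The
measure of a clause is the multiset that contains, for every side, its rank as often as the side has
variables beyond the first one (`RankedSides.excess`). Multisets of numbers are ordered by
`Relation.CutExpand (· < ·)`: one number is replaced by finitely many smaller ones.

Consider a split of `R(x ∘ t, y ∘ t')` that cuts `x` into `x₁ ∘ x₂`. The new constraints inherit the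
ranks of their ancestors, and these still decrease along all edges, because the edges of the new
graph project to edges of the old one; so chain-freeness is preserved. The side `y ∘ t'`, with
`t'` nonempty, is distributed over the two constraints `R₁(x₁, y)` and `R₂(x₂ ∘ t, t')`, so one copy
of its rank `r` disappears. Every other occurrence of `x` becomes one position longer; but the
positions of the side `y ∘ t'` have edges to all these occurrences, so only numbers below `r` are
added. Hence the measure decreases (`RankedSides.Ranking.split`, `HasMeasure.split`). A step of the
algorithm replaces a clause by finitely many clauses of smaller measure, and `Relation.CutExpand`,
applied a second time, shows that there is no infinite run (`acc_input`).

The side of largest rank consists of root nodes, so a nonempty reminder has a root constraint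
(`exists_isRootConstraint`). If no concatenation-free one is left to drop, it can be split, or else
the first phase can end; the second phase goes on as long as some constraint is not
concatenation-free (`Reached.exists_eq_phase2`). Finally, a run of a transducer that reads
`η(x ∘ t)` and `η(y ∘ t')` can be cut at the moment at which the first of `η x` and `η y` has been
read completely, so that splits preserve satisfiability (`satisfiable_split_iff`).
-/

namespace StringConstraints

universe u v

/-! ### Satisfiability is preserved by splitting -/

section Automata

theorem isPath_of_step_eq {A Q : Type*} {M N : εNFA A Q} (h : M.step = N.step) {s t : Q}
    {l : List (Option A)} (hp : M.IsPath s t l) : N.IsPath s t l := by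
  induction hp with
  | nil s => exact .nil s
  | cons t s u a x hstep _ ih => exact .cons t s u a x (h ▸ hstep) ih

variable {α : Type u}

theorem Transducer.append_mem_accepts_iff (T : Transducer α) (w₁ w₂ : List (Option α × Option α)) :
    w₁ ++ w₂ ∈ T.nfa.accepts ↔
      ∃ q : T.Q, w₁ ∈ (T.stopAt q).nfa.accepts ∧ w₂ ∈ (T.startAt q).nfa.accepts := by
  simp only [εNFA.mem_accepts_iff_exists_path]
  constructor
  · rintro ⟨s, t, l, hs, ht, hl, hp⟩
    obtain ⟨l₁, l₂, rfl, h₁, h₂⟩ := List.filterMap_eq_append_iff.1 hl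
    obtain ⟨q, hq₁, hq₂⟩ := T.nfa.isPath_append.1 hp
    exact ⟨q, ⟨s, q, l₁, hs, rfl, h₁,
        isPath_of_step_eq (M := T.nfa) (N := (T.stopAt q).nfa) rfl hq₁⟩,
      ⟨q, t, l₂, rfl, ht, h₂,
        isPath_of_step_eq (M := T.nfa) (N := (T.startAt q).nfa) rfl hq₂⟩⟩
  · rintro ⟨q, ⟨s, q₁, l₁, hs, hq₁, h₁, hp₁⟩, ⟨q₂, t, l₂, hq₂, ht, h₂, hp₂⟩⟩
    rw [show q₁ = q from hq₁] at hp₁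
    rw [show q₂ = q from hq₂] at hp₂
    refine ⟨s, t, l₁ ++ l₂, hs, ht, ?_, T.nfa.isPath_append.2
      ⟨q, isPath_of_step_eq (M := (T.stopAt q).nfa) (N := T.nfa) rfl hp₁,
        isPath_of_step_eq (M := (T.startAt q).nfa) (N := T.nfa) rfl hp₂⟩⟩
    rw [List.reduceOption_append, h₁, h₂]

/-- Words related by the two halves of a split concatenate to related words. -/
theorem RelSym.append_mem_relation {R : RelSym α} {R' : RelSym α × RelSym α} (hR : R' ∈ R.splits)
    {u u' w w' : List α} (h₁ : (u, w) ∈ R'.1.relation) (h₂ : (u', w') ∈ R'.2.relation) :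
    (u ++ u', w ++ w') ∈ R.relation := by
  cases R with
  | eq =>
    simp only [splits, List.mem_singleton] at hR
    subst hR
    simp only [relation, Set.mem_ofPred_eq] at *
    rw [h₁, h₂]
  | trans T =>
    simp only [splits, List.mem_map] at hR
    obtain ⟨q, -, rfl⟩ := hR
    obtain ⟨l₁, hl₁, hu, hw⟩ := h₁
    obtain ⟨l₂, hl₂, hu', hw'⟩ := h₂
    dsimp only at hu hw hu' hw'
    refine ⟨l₁ ++ l₂, (T.append_mem_accepts_iff _ _).2 ⟨q, hl₁, hl₂⟩, ?_, ?_⟩ <;>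
      simp [hu, hw, hu', hw']

/-- A run of a transducer can be cut wherever the first tape has been read up to a given point. -/
theorem RelSym.exists_split_of_append_left {R : RelSym α} {u u' w : List α}
    (h : (u ++ u', w) ∈ R.relation) : ∃ R' ∈ R.splits, ∃ w₁ w₂, w = w₁ ++ w₂ ∧
      (u, w₁) ∈ R'.1.relation ∧ (u', w₂) ∈ R'.2.relation := by
  cases R with
  | eq => exact ⟨(.eq, .eq), by simp [splits], u, u', h.symm, rfl, rfl⟩
  | trans T =>
    obtain ⟨l, hl, hu, hw⟩ := h
    dsimp only at hu hw
    obtain ⟨l₁, l₂, rfl, h₁, h₂⟩ := List.filterMap_eq_append_iff.1 hu.symm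
    obtain ⟨q, hq₁, hq₂⟩ := (T.append_mem_accepts_iff _ _).1 hl
    exact ⟨_, List.mem_map.2 ⟨q, by simp, rfl⟩, _, _, hw.trans List.filterMap_append,
      ⟨l₁, hq₁, h₁.symm, rfl⟩, ⟨l₂, hq₂, h₂.symm, rfl⟩⟩

/-- A run of a transducer can be cut wherever the second tape has been read up to a given point. -/
theorem RelSym.exists_split_of_append_right {R : RelSym α} {u w w' : List α}
    (h : (u, w ++ w') ∈ R.relation) : ∃ R' ∈ R.splits, ∃ u₁ u₂, u = u₁ ++ u₂ ∧
      (u₁, w) ∈ R'.1.relation ∧ (u₂, w') ∈ R'.2.relation := by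
  cases R with
  | eq => exact ⟨(.eq, .eq), by simp [splits], w, w', h, rfl, rfl⟩
  | trans T =>
    obtain ⟨l, hl, hu, hw⟩ := h
    dsimp only at hu hw
    obtain ⟨l₁, l₂, rfl, h₁, h₂⟩ := List.filterMap_eq_append_iff.1 hw.symm
    obtain ⟨q, hq₁, hq₂⟩ := (T.append_mem_accepts_iff _ _).1 hl
    exact ⟨_, List.mem_map.2 ⟨q, by simp, rfl⟩, _, _, hu.trans List.filterMap_append,
      ⟨l₁, hq₁, rfl, h₁.symm⟩, ⟨l₂, hq₂, rfl, h₂.symm⟩⟩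

/-- If `R` relates `u ++ u'` to `w ++ w'`, then either `w` is finished no later than `u` and `u` is
cut at that moment, or the other way round. -/
theorem RelSym.exists_split_of_append {R : RelSym α} {u u' w w' : List α}
    (h : (u ++ u', w ++ w') ∈ R.relation) : ∃ R' ∈ R.splits,
      (∃ u₁ u₂, u = u₁ ++ u₂ ∧ (u₁, w) ∈ R'.1.relation ∧ (u₂ ++ u', w') ∈ R'.2.relation) ∨
      (∃ w₁ w₂, w = w₁ ++ w₂ ∧ (u, w₁) ∈ R'.1.relation ∧ (u', w₂ ++ w') ∈ R'.2.relation) := by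
  cases R with
  | eq =>
    refine ⟨(.eq, .eq), by simp [splits], ?_⟩
    rcases List.append_eq_append_iff.1 (show u ++ u' = w ++ w' from h) with
      ⟨a, rfl, rfl⟩ | ⟨a, rfl, rfl⟩
    · exact .inr ⟨u, a, rfl, rfl, rfl⟩
    · exact .inl ⟨w, a, rfl, rfl, rfl⟩
  | trans T =>
    obtain ⟨l, hl, hu, hw⟩ := h
    dsimp only at hu hw
    obtain ⟨l₁, l₂, rfl, h₁, h₂⟩ := List.filterMap_eq_append_iff.1 hu.symm
    obtain ⟨l₃, l₄, h, h₃, h₄⟩ := List.filterMap_eq_append_iff.1 hw.symm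
    -- `l₁` is the part of the run that reads `u`, and `l₃` the part that reads `w`
    rcases List.append_eq_append_iff.1 h with ⟨z, rfl, rfl⟩ | ⟨z, rfl, rfl⟩
    · obtain ⟨q, hq₁, hq₂⟩ := (T.append_mem_accepts_iff _ _).1 hl
      refine ⟨_, List.mem_map.2 ⟨q, by simp, rfl⟩, .inr ⟨_, _,
        h₃.symm.trans List.filterMap_append, ⟨l₁, hq₁, h₁.symm, rfl⟩, ⟨_, hq₂, h₂.symm, ?_⟩⟩⟩
      simp [h₄]
    · rw [h] at hl
      obtain ⟨q, hq₁, hq₂⟩ := (T.append_mem_accepts_iff _ _).1 hl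
      refine ⟨_, List.mem_map.2 ⟨q, by simp, rfl⟩, .inl ⟨_, _,
        h₁.symm.trans List.filterMap_append, ⟨l₃, hq₁, rfl, h₃.symm⟩, ⟨_, hq₂, ?_, h₄.symm⟩⟩⟩
      simp [h₂]

end Automata

section Substitution

variable {α : Type u} {V : Type v} [DecidableEq V]

theorem StrTerm.toList_subst (x x₁ x₂ : V) (t : StrTerm V) :
    (t.subst x x₁ x₂).toList = substVars x x₁ x₂ t.toList := by
  simp only [StrTerm.subst, StrTerm.toList, substVars, List.flatMap_cons]
  split <;> rfl

theorem substVars_eq_self {x x₁ x₂ : V} {l : List V} (h : x ∉ l) : substVars x x₁ x₂ l = l := by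
  induction l with
  | nil => rfl
  | cons z l ih =>
    simp only [List.mem_cons, not_or] at h
    have := ih h.2
    simp only [substVars] at this
    simp [substVars, Ne.symm h.1, this]

/-- The interpretation that gives `x` the value of `x₁ ∘ x₂`. -/
def glue (x x₁ x₂ : V) (η : V → List α) : V → List α := Function.update η x (η x₁ ++ η x₂)

theorem StrTerm.eval_subst (x x₁ x₂ : V) (η : V → List α) (t : StrTerm V) :
    (t.subst x x₁ x₂).eval η = t.eval (glue x x₁ x₂ η) := by
  rw [StrTerm.eval, StrTerm.eval, StrTerm.toList_subst, substVars, List.flatMap_assoc]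
  congr 1
  funext z
  by_cases h : z = x
  · subst h; simp [glue]
  · simp [glue, h]

theorem RelConstraint.holds_subst (x x₁ x₂ : V) (η : V → List α) (φ : RelConstraint α V) :
    (φ.subst x x₁ x₂).Holds η ↔ φ.Holds (glue x x₁ x₂ η) := by
  simp only [RelConstraint.Holds, RelConstraint.subst, StrTerm.eval_subst]

theorem ArithTerm.eval_subst (x x₁ x₂ : V) (η : V → List α) (a : ArithTerm V) :
    (a.subst x x₁ x₂).eval η = a.eval (glue x x₁ x₂ η) := by
  induction a <;> simp_all [ArithTerm.subst, ArithTerm.eval, StrTerm.eval_subst]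

theorem SideLiteral.holds_subst (x x₁ x₂ : V) (η : V → List α) (l : SideLiteral α V) :
    (l.subst x x₁ x₂).Holds η ↔ l.Holds (glue x x₁ x₂ η) := by
  obtain ⟨b, t | t⟩ := l <;>
    simp [SideLiteral.Holds, SideLiteral.subst, SideAtom.subst, SideAtom.Holds,
      StrTerm.eval_subst, ArithTerm.eval_subst]

theorem StrTerm.eval_congr {V : Type v} {η η' : V → List α} {t : StrTerm V} (h : ∀ z ∈ t.toList, η z = η' z) :
    t.eval η = t.eval η' := List.flatMap_congr h

theorem ArithTerm.eval_congr {V : Type v} {η η' : V → List α} {a : ArithTerm V}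
    (h : ∀ z ∈ a.vars, η z = η' z) : a.eval η = a.eval η' := by
  induction a with
  | const => rfl
  | len t => simp only [ArithTerm.eval, StrTerm.eval_congr h]
  | add a b iha ihb =>
    simp only [ArithTerm.vars, List.mem_append] at h
    simp only [ArithTerm.eval, iha fun z hz => h z (.inl hz), ihb fun z hz => h z (.inr hz)]
  | smul k a ih => simp only [ArithTerm.eval, ih h]

/-- Whether a clause holds depends on the values of its variables only. -/
theorem Clause.holds_of_eqOn {V : Type v} {η η' : V → List α} {C : Clause α V}
    (h : ∀ z ∈ C.vars, η z = η' z) (hC : C.Holds η) : C.Holds η' := by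
  simp only [Clause.vars, List.mem_append, List.mem_flatMap] at h
  refine ⟨fun φ hφ => ?_, fun l hl => ?_⟩
  · have h' : ∀ z ∈ φ.vars, η z = η' z := fun z hz => h z (.inl ⟨φ, hφ, hz⟩)
    simp only [RelConstraint.vars, List.mem_append] at h'
    have := hC.1 φ hφ
    rwa [RelConstraint.Holds, StrTerm.eval_congr fun z hz => h' z (.inl hz),
      StrTerm.eval_congr (t := φ.rhs) fun z hz => h' z (.inr hz)] at this
  · have h' : ∀ z ∈ l.atom.vars, η z = η' z := fun z hz => h z (.inr ⟨l, hl, hz⟩)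
    have := hC.2 l hl
    obtain ⟨b, t | ⟨a, a'⟩⟩ := l
    · simpa only [SideLiteral.Holds, SideAtom.Holds, StrTerm.eval_congr h'] using this
    · simp only [SideAtom.vars, List.mem_append] at h'
      simpa only [SideLiteral.Holds, SideAtom.Holds,
        ArithTerm.eval_congr fun z hz => h' z (.inl hz),
        ArithTerm.eval_congr (a := a') fun z hz => h' z (.inr hz)] using this

/-- The clause obtained from `Γ₁ ∧ φ ∧ Γ₂` by a disjunct of a split of `φ`. -/
def SplitCase.child (c : SplitCase α V) (Γ₁ Γ₂ : List (RelConstraint α V))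
    (side : List (SideLiteral α V)) : Clause α V := ⟨c.newRels Γ₁ Γ₂, c.newSide side⟩

theorem holds_lengthConstraint {V : Type v} {x x₁ x₂ : V} {η : V → List α}
    (h : η x = η x₁ ++ η x₂) {l : SideLiteral α V} (hl : l ∈ lengthConstraint x x₁ x₂) :
    l.Holds η := by
  simp only [lengthConstraint, List.mem_cons, List.not_mem_nil, or_false] at hl
  rcases hl with rfl | rfl <;>
    simp [SideLiteral.Holds, SideAtom.Holds, ArithTerm.eval, StrTerm.eval, StrTerm.toList,
      StrTerm.var, h]

theorem SplitCase.child_holds_iff {c : SplitCase α V} {Γ₁ Γ₂ : List (RelConstraint α V)}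
    {side : List (SideLiteral α V)} {η : V → List α} :
    (c.child Γ₁ Γ₂ side).Holds η ↔
      (Clause.mk (Γ₁ ++ Γ₂) side).Holds (glue c.x c.x₁ c.x₂ η) ∧ c.fst.Holds η ∧ c.snd.Holds η ∧
        ∀ l ∈ lengthConstraint c.x c.x₁ c.x₂, SideLiteral.Holds η l := by
  simp only [SplitCase.child, SplitCase.newRels, SplitCase.newSide, Clause.Holds, List.mem_append,
    List.mem_cons, List.mem_map]
  constructor
  · rintro ⟨hr, hs⟩
    refine ⟨⟨?_, ?_⟩, hr _ (.inr (.inl rfl)), hr _ (.inr (.inr (.inl rfl))),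
      fun l hl => hs l (.inr hl)⟩
    · rintro φ (h | h)
      · exact (RelConstraint.holds_subst ..).1 (hr _ (.inl ⟨φ, h, rfl⟩))
      · exact (RelConstraint.holds_subst ..).1 (hr _ (.inr (.inr (.inr ⟨φ, h, rfl⟩))))
    · exact fun l hl => (SideLiteral.holds_subst ..).1 (hs _ (.inl ⟨l, hl, rfl⟩))
  · rintro ⟨⟨hr, hs⟩, h₁, h₂, hl⟩
    refine ⟨?_, ?_⟩
    · rintro φ (⟨φ, h, rfl⟩ | rfl | rfl | ⟨φ, h, rfl⟩)
      · exact (RelConstraint.holds_subst ..).2 (hr _ (.inl h))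
      · exact h₁
      · exact h₂
      · exact (RelConstraint.holds_subst ..).2 (hr _ (.inr h))
    · rintro l (⟨l, h, rfl⟩ | h)
      · exact (SideLiteral.holds_subst ..).2 (hs _ h)
      · exact hl l h

theorem RelConstraint.mem_leftSplit {φ : RelConstraint α V} {x₁ x₂ : V} {c : SplitCase α V} :
    c ∈ φ.leftSplit x₁ x₂ ↔ ∃ b l, φ.rhs.tail = b :: l ∧ ∃ R ∈ φ.rel.splits,
      c = ⟨φ.lhs.head, x₁, x₂, subst φ.lhs.head x₁ x₂ ⟨R.1, .var x₁, .var φ.rhs.head⟩,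
        subst φ.lhs.head x₁ x₂ ⟨R.2, ⟨x₂, φ.lhs.tail⟩, ⟨b, l⟩⟩⟩ := by
  rw [leftSplit]
  split
  · next h => simp [h]
  · next b l h => simp [h, eq_comm]

theorem RelConstraint.mem_rightSplit {φ : RelConstraint α V} {y₁ y₂ : V} {c : SplitCase α V} :
    c ∈ φ.rightSplit y₁ y₂ ↔ ∃ a l, φ.lhs.tail = a :: l ∧ ∃ R ∈ φ.rel.splits,
      c = ⟨φ.rhs.head, y₁, y₂, subst φ.rhs.head y₁ y₂ ⟨R.1, .var φ.lhs.head, .var y₁⟩,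
        subst φ.rhs.head y₁ y₂ ⟨R.2, ⟨a, l⟩, ⟨y₂, φ.rhs.tail⟩⟩⟩ := by
  rw [rightSplit]
  split
  · next h => simp [h]
  · next b l h => simp [h, eq_comm]

theorem StrTerm.eval_mk {V : Type v} (η : V → List α) (z : V) (l : List V) :
    (StrTerm.mk z l).eval η = η z ++ l.flatMap η := by simp [StrTerm.eval, StrTerm.toList]

theorem StrTerm.eval_var {V : Type v} (η : V → List α) (z : V) :
    (StrTerm.var z).eval η = η z := by simp [StrTerm.eval, StrTerm.toList, StrTerm.var]

/-- If the two new constraints of a disjunct of a split hold, then the split constraint holds once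
the two parts of the split variable are glued together. -/
theorem RelConstraint.holds_of_split {φ : RelConstraint α V} {x₁ x₂ y₁ y₂ : V}
    {c : SplitCase α V} (hc : c ∈ φ.split x₁ x₂ y₁ y₂)
    (hx₁ : x₁ ∉ φ.vars) (hx₂ : x₂ ∉ φ.vars) (hy₁ : y₁ ∉ φ.vars) (hy₂ : y₂ ∉ φ.vars)
    {η : V → List α} (h₁ : c.fst.Holds η) (h₂ : c.snd.Holds η) :
    φ.Holds (glue c.x c.x₁ c.x₂ η) := by
  have hl : φ.lhs.head ∈ φ.vars := by simp [vars, StrTerm.toList]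
  have hr : φ.rhs.head ∈ φ.vars := by simp [vars, StrTerm.toList]
  obtain ⟨R, ⟨x, t⟩, ⟨y, t'⟩⟩ := φ
  dsimp only at hl hr
  rw [split, List.mem_append] at hc
  rcases hc with hc | hc
  · obtain ⟨b, l, rfl, R', hR', rfl⟩ := mem_leftSplit.1 hc
    dsimp only at *
    rw [holds_subst, Holds] at h₁ h₂
    have := RelSym.append_mem_relation hR' h₁ h₂
    have e₁ : x₁ ≠ x := fun h => hx₁ (h ▸ hl)
    have e₂ : x₂ ≠ x := fun h => hx₂ (h ▸ hl)
    simp only [StrTerm.eval_mk, StrTerm.eval_var] at this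
    simp only [Holds, StrTerm.eval_mk]
    rw [← List.append_assoc] at this
    convert! this using 3
    simp [glue, e₁, e₂]
  · obtain ⟨b, l, rfl, R', hR', rfl⟩ := mem_rightSplit.1 hc
    dsimp only at *
    rw [holds_subst, Holds] at h₁ h₂
    have := RelSym.append_mem_relation hR' h₁ h₂
    have e₁ : y₁ ≠ y := fun h => hy₁ (h ▸ hr)
    have e₂ : y₂ ≠ y := fun h => hy₂ (h ▸ hr)
    simp only [StrTerm.eval_mk, StrTerm.eval_var] at this
    simp only [Holds, StrTerm.eval_mk]
    rw [← List.append_assoc (glue _ _ _ η y₁)] at this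
    convert! this using 3
    simp [glue, e₁, e₂]

/-- If a constraint that is not concatenation-free holds, then some disjunct of its split holds
for a suitable cut of the value of the split variable. -/
theorem RelConstraint.exists_split_of_holds {φ : RelConstraint α V} (hφ : ¬ φ.ConcatFree)
    (x₁ x₂ y₁ y₂ : V) {η : V → List α} (h : φ.Holds η) :
    ∃ c ∈ φ.split x₁ x₂ y₁ y₂, ∃ w₁ w₂, η c.x = w₁ ++ w₂ ∧ c.x ∈ φ.vars ∧
      (c.x₁ = x₁ ∧ c.x₂ = x₂ ∨ c.x₁ = y₁ ∧ c.x₂ = y₂) ∧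
      ∀ η' : V → List α, glue c.x c.x₁ c.x₂ η' = η' → (∀ z ∈ φ.vars, η' z = η z) →
        η' c.x₁ = w₁ → η' c.x₂ = w₂ → c.fst.Holds η' ∧ c.snd.Holds η' := by
  obtain ⟨R, ⟨x, t⟩, ⟨y, t'⟩⟩ := φ
  simp only [Holds, StrTerm.eval_mk] at h
  have left : ∀ b l R', t' = b :: l → R' ∈ R.splits → ∀ u₁ u₂, η x = u₁ ++ u₂ →
      (u₁, η y) ∈ R'.1.relation → (u₂ ++ t.flatMap η, t'.flatMap η) ∈ R'.2.relation →
      ∃ c ∈ split ⟨R, ⟨x, t⟩, ⟨y, t'⟩⟩ x₁ x₂ y₁ y₂, ∃ w₁ w₂, η c.x = w₁ ++ w₂ ∧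
        c.x ∈ vars ⟨R, ⟨x, t⟩, ⟨y, t'⟩⟩ ∧ (c.x₁ = x₁ ∧ c.x₂ = x₂ ∨ c.x₁ = y₁ ∧ c.x₂ = y₂) ∧
        ∀ η' : V → List α, glue c.x c.x₁ c.x₂ η' = η' →
          (∀ z ∈ vars ⟨R, ⟨x, t⟩, ⟨y, t'⟩⟩, η' z = η z) →
          η' c.x₁ = w₁ → η' c.x₂ = w₂ → c.fst.Holds η' ∧ c.snd.Holds η' := by
    rintro b l R' rfl hR' u₁ u₂ hu h₁ h₂
    refine ⟨_, List.mem_append_left _ (mem_leftSplit.2 ⟨b, l, rfl, R', hR', rfl⟩), u₁, u₂, hu,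
      by simp [vars, StrTerm.toList], .inl ⟨rfl, rfl⟩, fun η' hg he h₁' h₂' => ?_⟩
    dsimp only at hg h₁' h₂'
    have et : t.flatMap η' = t.flatMap η :=
      List.flatMap_congr fun z hz => he z (by simp [vars, StrTerm.toList, hz])
    have et' : (b :: l).flatMap η' = (b :: l).flatMap η :=
      List.flatMap_congr fun z hz => he z (by
        rw [vars]; exact List.mem_append_right _ (List.mem_cons_of_mem _ hz))
    have ey : η' y = η y := he y (by simp [vars, StrTerm.toList])
    rw [List.flatMap_cons, List.flatMap_cons] at et'
    rw [List.flatMap_cons] at h₂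
    rw [holds_subst, holds_subst, hg]
    simp only [Holds, StrTerm.eval_mk, StrTerm.eval_var, ey, et, et', h₁', h₂']
    exact ⟨h₁, h₂⟩
  have right : ∀ b l R', t = b :: l → R' ∈ R.splits → ∀ u₁ u₂, η y = u₁ ++ u₂ →
      (η x, u₁) ∈ R'.1.relation → (t.flatMap η, u₂ ++ t'.flatMap η) ∈ R'.2.relation →
      ∃ c ∈ split ⟨R, ⟨x, t⟩, ⟨y, t'⟩⟩ x₁ x₂ y₁ y₂, ∃ w₁ w₂, η c.x = w₁ ++ w₂ ∧
        c.x ∈ vars ⟨R, ⟨x, t⟩, ⟨y, t'⟩⟩ ∧ (c.x₁ = x₁ ∧ c.x₂ = x₂ ∨ c.x₁ = y₁ ∧ c.x₂ = y₂) ∧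
        ∀ η' : V → List α, glue c.x c.x₁ c.x₂ η' = η' →
          (∀ z ∈ vars ⟨R, ⟨x, t⟩, ⟨y, t'⟩⟩, η' z = η z) →
          η' c.x₁ = w₁ → η' c.x₂ = w₂ → c.fst.Holds η' ∧ c.snd.Holds η' := by
    rintro b l R' rfl hR' u₁ u₂ hu h₁ h₂
    refine ⟨_, List.mem_append_right _ (mem_rightSplit.2 ⟨b, l, rfl, R', hR', rfl⟩), u₁, u₂, hu,
      by simp [vars, StrTerm.toList], .inr ⟨rfl, rfl⟩, fun η' hg he h₁' h₂' => ?_⟩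
    dsimp only at hg h₁' h₂'
    have et : t'.flatMap η' = t'.flatMap η :=
      List.flatMap_congr fun z hz => he z (by simp [vars, StrTerm.toList, hz])
    have et' : (b :: l).flatMap η' = (b :: l).flatMap η :=
      List.flatMap_congr fun z hz => he z (by
        rw [vars]; exact List.mem_append_left _ (List.mem_cons_of_mem _ hz))
    have ex : η' x = η x := he x (by simp [vars, StrTerm.toList])
    rw [List.flatMap_cons, List.flatMap_cons] at et'
    rw [List.flatMap_cons] at h₂
    rw [holds_subst, holds_subst, hg]
    simp only [Holds, StrTerm.eval_mk, StrTerm.eval_var, ex, et, et', h₁', h₂']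
    exact ⟨h₁, h₂⟩
  rcases t with _ | ⟨a, t⟩ <;> rcases t' with _ | ⟨b, t'⟩
  · exact absurd ⟨rfl, rfl⟩ hφ
  · obtain ⟨R', hR', u₁, u₂, hu, h₁, h₂⟩ := RelSym.exists_split_of_append_right h
    rw [List.flatMap_nil, List.append_nil] at hu
    exact left b t' R' rfl hR' u₁ u₂ hu h₁ (by simpa using h₂)
  · obtain ⟨R', hR', u₁, u₂, hu, h₁, h₂⟩ := RelSym.exists_split_of_append_left h
    rw [List.flatMap_nil, List.append_nil] at hu
    exact right a t R' rfl hR' u₁ u₂ hu h₁ (by simpa using h₂)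
  · obtain ⟨R', hR', ⟨u₁, u₂, hu, h₁, h₂⟩ | ⟨u₁, u₂, hu, h₁, h₂⟩⟩ :=
      RelSym.exists_split_of_append h
    · exact left b t' R' rfl hR' u₁ u₂ hu h₁ h₂
    · exact right a t R' rfl hR' u₁ u₂ hu h₁ h₂

theorem Clause.vars_subset_of_mem {V : Type v} {C : Clause α V} {φ : RelConstraint α V}
    (hφ : φ ∈ C.rels) {z : V} (hz : z ∈ φ.vars) : z ∈ C.vars :=
  List.mem_append_left _ (List.mem_flatMap.2 ⟨φ, hφ, hz⟩)

/-- A splitting step preserves satisfiability. -/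
theorem satisfiable_split_iff {Γ₁ Γ₂ : List (RelConstraint α V)} {φ : RelConstraint α V}
    {side : List (SideLiteral α V)} {x₁ x₂ y₁ y₂ : V} (hφ : ¬ φ.ConcatFree)
    (hfresh : FreshFor ⟨Γ₁ ++ φ :: Γ₂, side⟩ x₁ x₂ y₁ y₂) :
    (∃ η : V → List α, (Clause.mk (Γ₁ ++ φ :: Γ₂) side).Holds η) ↔
      ∃ c ∈ φ.split x₁ x₂ y₁ y₂, ∃ η : V → List α, (c.child Γ₁ Γ₂ side).Holds η := by
  obtain ⟨hnd, hf⟩ := hfresh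
  simp only [List.mem_cons, List.not_mem_nil, or_false, forall_eq_or_imp, forall_eq] at hf
  obtain ⟨hx₁, hx₂, hy₁, hy₂⟩ := hf
  have hmem : ∀ z ∈ φ.vars, z ∈ (Clause.mk (Γ₁ ++ φ :: Γ₂) side).vars := fun z hz =>
    Clause.vars_subset_of_mem (φ := φ) (by simp) hz
  constructor
  · rintro ⟨η, h⟩
    obtain ⟨c, hc, w₁, w₂, hw, hx, hnew, hη⟩ :=
      RelConstraint.exists_split_of_holds hφ x₁ x₂ y₁ y₂ (h.1 φ (by simp))
    have hne : c.x₁ ≠ c.x₂ := by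
      rcases hnew with ⟨h, h'⟩ | ⟨h, h'⟩ <;> rw [h, h'] <;> simp at hnd <;> tauto
    have h₁ : c.x₁ ∉ (Clause.mk (Γ₁ ++ φ :: Γ₂) side).vars := by
      rcases hnew with ⟨h, -⟩ | ⟨h, -⟩ <;> rw [h] <;> assumption
    have h₂ : c.x₂ ∉ (Clause.mk (Γ₁ ++ φ :: Γ₂) side).vars := by
      rcases hnew with ⟨-, h⟩ | ⟨-, h⟩ <;> rw [h] <;> assumption
    set η' : V → List α := Function.update (Function.update η c.x₁ w₁) c.x₂ w₂ with hη'
    have e₁ : η' c.x₁ = w₁ := by simp [η', hne]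
    have e₂ : η' c.x₂ = w₂ := by simp [η']
    have hagree : ∀ z ∈ (Clause.mk (Γ₁ ++ φ :: Γ₂) side).vars, η' z = η z := fun z hz => by
      have n₁ : z ≠ c.x₁ := fun h => h₁ (h ▸ hz)
      have n₂ : z ≠ c.x₂ := fun h => h₂ (h ▸ hz)
      simp [η', n₁, n₂]
    have hx' : η' c.x = η' c.x₁ ++ η' c.x₂ := by rw [hagree _ (hmem _ hx), hw, e₁, e₂]
    have hg : glue c.x c.x₁ c.x₂ η' = η' := by rw [glue, ← hx', Function.update_eq_self]
    obtain ⟨hfst, hsnd⟩ := hη η' hg (fun z hz => hagree z (hmem z hz)) e₁ e₂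
    refine ⟨c, hc, η', SplitCase.child_holds_iff.2 ⟨?_, hfst, hsnd, fun l hl =>
      holds_lengthConstraint hx' hl⟩⟩
    rw [hg]
    have := Clause.holds_of_eqOn (fun z hz => (hagree z hz).symm) h
    exact ⟨fun ψ hψ => this.1 ψ (by simp at hψ ⊢; tauto), this.2⟩
  · rintro ⟨c, hc, η, h⟩
    obtain ⟨⟨hr, hs⟩, h₁, h₂, -⟩ := SplitCase.child_holds_iff.1 h
    refine ⟨_, fun ψ hψ => ?_, hs⟩
    have : ψ = φ ∨ ψ ∈ Γ₁ ++ Γ₂ := by simp at hψ ⊢; tauto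
    rcases this with rfl | h
    · exact RelConstraint.holds_of_split hc (fun h => hx₁ (hmem _ h)) (fun h => hx₂ (hmem _ h))
        (fun h => hy₁ (hmem _ h)) (fun h => hy₂ (hmem _ h)) h₁ h₂
    · exact hr ψ h

end Substitution

section NormalForm

variable {α : Type u} {V : Type v}

theorem RelSym.relation_compl {R : RelSym α} (h : R.Invertible) :
    R.compl.relation = R.relationᶜ := by
  rw [RelSym.compl, dif_pos h]
  exact h.choose_spec

theorem Clause.holds_conj {η : V → List α} {C D : Clause α V} :
    (C.conj D).Holds η ↔ C.Holds η ∧ D.Holds η := by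
  simp only [Clause.Holds, Clause.conj, List.forall_mem_append]
  tauto

theorem StringFormula.exists_mem_dnfAux_iff (η : V → List α) (Ψ : StringFormula α V) :
    ∀ pol, Ψ.NegativesInvertible pol →
      ((∃ C ∈ Ψ.dnfAux pol, C.Holds η) ↔ (Ψ.Holds η ↔ pol = true)) := by
  induction Ψ with
  | rel φ =>
    rintro (_ | _) h
    · have := RelSym.relation_compl (h rfl)
      simp [dnfAux, Clause.Holds, StringFormula.Holds, RelConstraint.Holds, this]
    · simp [dnfAux, Clause.Holds, StringFormula.Holds]
  | side a =>
    rintro (_ | _) - <;> simp [dnfAux, Clause.Holds, StringFormula.Holds, SideLiteral.Holds]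
  | neg Ψ ih =>
    intro pol h
    rw [dnfAux, ih _ h, StringFormula.Holds]
    cases pol <;> simp
  | and Ψ Θ ih ih' =>
    rintro (_ | _) ⟨h, h'⟩ <;> have e := ih _ h <;> have e' := ih' _ h'
    · simp only [dnfAux, List.mem_append, or_and_right, exists_or, e, e', StringFormula.Holds]
      simp; tauto
    · simp only [dnfAux, List.mem_flatMap, List.mem_map, StringFormula.Holds]
      simp only [iff_true] at e e' ⊢
      rw [← e, ← e']
      constructor
      · rintro ⟨_, ⟨C, hC, D, hD, rfl⟩, hCD⟩
        rw [Clause.holds_conj] at hCD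
        exact ⟨⟨C, hC, hCD.1⟩, ⟨D, hD, hCD.2⟩⟩
      · rintro ⟨⟨C, hC, h₁⟩, ⟨D, hD, h₂⟩⟩
        exact ⟨_, ⟨C, hC, D, hD, rfl⟩, Clause.holds_conj.2 ⟨h₁, h₂⟩⟩
  | or Ψ Θ ih ih' =>
    rintro (_ | _) ⟨h, h'⟩ <;> have e := ih _ h <;> have e' := ih' _ h'
    · simp only [dnfAux, List.mem_flatMap, List.mem_map, StringFormula.Holds]
      simp only [Bool.false_eq_true, iff_false, not_or] at e e' ⊢
      rw [← e, ← e']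
      constructor
      · rintro ⟨_, ⟨C, hC, D, hD, rfl⟩, hCD⟩
        rw [Clause.holds_conj] at hCD
        exact ⟨⟨C, hC, hCD.1⟩, ⟨D, hD, hCD.2⟩⟩
      · rintro ⟨⟨C, hC, h₁⟩, ⟨D, hD, h₂⟩⟩
        exact ⟨_, ⟨C, hC, D, hD, rfl⟩, Clause.holds_conj.2 ⟨h₁, h₂⟩⟩
    · simp only [dnfAux, List.mem_append, or_and_right, exists_or, e, e', StringFormula.Holds]
      simp

theorem StringFormula.satisfiable_dnf_iff {Ψ : StringFormula α V} (hwf : Ψ.WellFormed) :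
    Ψ.dnf.Satisfiable ↔ Ψ.Satisfiable :=
  exists_congr fun η => (Ψ.exists_mem_dnfAux_iff η true hwf).trans (by simp)

end NormalForm

/-! ### Rankings of the sides of constraints -/

/-- The side opposite to a given one. -/
def Side.other : Side → Side
  | .left => .right
  | .right => .left

theorem Side.other_ne (s : Side) : s.other ≠ s := by cases s <;> simp [Side.other]

theorem Side.eq_or_eq_other (s s' : Side) : s' = s ∨ s' = s.other := by
  cases s <;> cases s' <;> simp [Side.other]

/-- The sequences of variables on the two sides of a relational constraint. -/
def RelConstraint.word {α : Type u} {V : Type v} (φ : RelConstraint α V) (s : Side) : List V :=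
  (φ.term s).toList

/-- What matters of a relational constraint for the splitting graph, namely the sequences of
variables on its sides, together with a rank for each of the two sides. -/
structure RankedSides (V : Type v) where
  word : Side → List V
  rank : Side → ℕ

namespace RankedSides

variable {V : Type v}

/-- The ranks decrease along all edges of the splitting graph inside a single constraint. As an
occurrence of a variable on both sides would yield a loop, the sides have no common variable. -/
def Coherent (a : RankedSides V) : Prop :=
  ∀ s, (∀ z ∈ a.word s, z ∉ a.word s.other) ∧
    (¬ (a.word s).Nodup → a.rank s < a.rank s.other)

/-- The ranks decrease along all edges of the splitting graph between two constraints: if `z`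
occurs on side `s` of `a` and on side `s'` of `b`, then all positions of `a` opposite to `s` have an
edge to the occurrence of `z` in `b`, and vice versa. -/
def Compatible (a b : RankedSides V) : Prop :=
  ∀ s s' z, z ∈ a.word s → z ∈ b.word s' →
    b.rank s' < a.rank s.other ∧ a.rank s < b.rank s'.other

theorem Compatible.symm {a b : RankedSides V} (h : a.Compatible b) : b.Compatible a :=
  fun s s' z hs hs' => (h s' s z hs' hs).symm

/-- The ranks of the sides of a conjunction of constraints decrease along all edges of its
splitting graph. -/
def Ranking (L : List (RankedSides V)) : Prop :=
  (∀ a ∈ L, a.Coherent) ∧ L.Pairwise Compatible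

theorem Ranking.perm {L L' : List (RankedSides V)} (h : L.Perm L') (hL : Ranking L) :
    Ranking L' :=
  ⟨fun a ha => hL.1 a (h.mem_iff.2 ha), hL.2.perm h fun h => h.symm⟩

theorem Ranking.sublist {L L' : List (RankedSides V)} (h : L'.Sublist L) (hL : Ranking L) :
    Ranking L' :=
  ⟨fun a ha => hL.1 a (h.subset ha), hL.2.sublist h⟩

/-- For each side, as many copies of its rank as the side has variables beyond the first one. -/
def excess (a : RankedSides V) : Multiset ℕ :=
  Multiset.replicate ((a.word .left).length - 1) (a.rank .left) +
    Multiset.replicate ((a.word .right).length - 1) (a.rank .right)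

theorem excess_eq (a : RankedSides V) (s : Side) :
    a.excess = Multiset.replicate ((a.word s).length - 1) (a.rank s) +
      Multiset.replicate ((a.word s.other).length - 1) (a.rank s.other) := by
  cases s
  · rfl
  · exact add_comm _ _

/-- The termination measure of a conjunction of constraints with ranked sides. -/
def totalExcess (L : List (RankedSides V)) : Multiset ℕ := (L.map excess).sum

theorem totalExcess_perm {L L' : List (RankedSides V)} (h : L.Perm L') :
    totalExcess L = totalExcess L' := (h.map _).sum_eq

/-- `a'` has the ranks of `a`, and `σ` maps the variables of `a'` to variables on the same sides
of `a`. -/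
def Refines (σ : V → V) (a' a : RankedSides V) : Prop :=
  a'.rank = a.rank ∧ ∀ s, ∀ z ∈ a'.word s, σ z ∈ a.word s

theorem Refines.compatible {σ : V → V} {a a' b b' : RankedSides V} (ha : Refines σ a' a)
    (hb : Refines σ b' b) (h : a.Compatible b) : a'.Compatible b' := by
  intro s s' z hs hs'
  rw [ha.1, hb.1]
  exact h s s' (σ z) (ha.2 s z hs) (hb.2 s' z hs')

theorem Refines.disjoint {σ : V → V} {a a' : RankedSides V} (ha : Refines σ a' a)
    (h : a.Coherent) (s : Side) : ∀ z ∈ a'.word s, z ∉ a'.word s.other :=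
  fun z hz hz' => (h s).1 (σ z) (ha.2 s z hz) (ha.2 s.other z hz')

section Subst

variable [DecidableEq V]

/-- Replace `x` by `x₁ ∘ x₂` and keep the ranks. -/
def subst (x x₁ x₂ : V) (a : RankedSides V) : RankedSides V :=
  ⟨fun s => substVars x x₁ x₂ (a.word s), a.rank⟩

/-- The variable from which a variable of a clause after a split originates. -/
def origin (x x₁ x₂ : V) (z : V) : V := if z = x₁ ∨ z = x₂ then x else z

theorem origin_mem_of_mem_substVars {x x₁ x₂ : V} {l : List V} (h₁ : x₁ ∉ l) (h₂ : x₂ ∉ l) {z : V}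
    (hz : z ∈ substVars x x₁ x₂ l) : origin x x₁ x₂ z ∈ l := by
  obtain ⟨y, hy, hz⟩ := List.mem_flatMap.1 hz
  split at hz
  · next h =>
    simp only [List.mem_cons, List.not_mem_nil, or_false] at hz
    rw [origin, if_pos hz]
    exact h ▸ hy
  · simp only [List.mem_cons, List.not_mem_nil, or_false] at hz
    subst hz
    have : ¬ (z = x₁ ∨ z = x₂) := by rintro (rfl | rfl) <;> contradiction
    rwa [origin, if_neg this]

theorem origin_eq_self {x x₁ x₂ z : V} (h₁ : z ≠ x₁) (h₂ : z ≠ x₂) : origin x x₁ x₂ z = z :=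
  if_neg (by tauto)

theorem refines_subst {x x₁ x₂ : V} {a : RankedSides V} (h₁ : ∀ s, x₁ ∉ a.word s)
    (h₂ : ∀ s, x₂ ∉ a.word s) : Refines (origin x x₁ x₂) (a.subst x x₁ x₂) a :=
  ⟨rfl, fun s _ hz => origin_mem_of_mem_substVars (h₁ s) (h₂ s) hz⟩

theorem length_substVars (x x₁ x₂ : V) (l : List V) :
    (substVars x x₁ x₂ l).length = l.length + l.count x := by
  induction l with
  | nil => rfl
  | cons z l ih =>
    simp only [substVars, List.flatMap_cons, List.length_append, List.length_cons] at ih ⊢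
    rw [ih, List.count_cons]
    by_cases h : z = x <;> simp [h] <;> omega

theorem nodup_substVars {x x₁ x₂ : V} {l : List V} (hne : x₁ ≠ x₂) (h₁ : x₁ ∉ l) (h₂ : x₂ ∉ l)
    (hl : l.Nodup) : (substVars x x₁ x₂ l).Nodup := by
  induction l with
  | nil => exact List.nodup_nil
  | cons z l ih =>
    simp only [List.mem_cons, not_or] at h₁ h₂
    rw [List.nodup_cons] at hl
    have ih := ih h₁.2 h₂.2 hl.2
    by_cases h : z = x
    · subst h
      have e := substVars_eq_self (x₁ := x₁) (x₂ := x₂) hl.1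
      simp only [substVars] at e
      simp [substVars, e, hne, h₁.2, h₂.2, hl.2]
    · have : z ∉ substVars x x₁ x₂ l := fun hz => by
        have := origin_mem_of_mem_substVars h₁.2 h₂.2 hz
        rw [origin_eq_self (Ne.symm h₁.1) (Ne.symm h₂.1)] at this
        exact hl.1 this
      simp only [substVars] at ih this
      simp [substVars, h, ih] at this ⊢
      exact this

theorem coherent_subst {x x₁ x₂ : V} {a : RankedSides V} (hne : x₁ ≠ x₂)
    (h₁ : ∀ s, x₁ ∉ a.word s) (h₂ : ∀ s, x₂ ∉ a.word s) (ha : a.Coherent) :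
    (a.subst x x₁ x₂).Coherent := fun s =>
  ⟨(refines_subst h₁ h₂).disjoint ha s, fun h =>
    (ha s).2 fun hs => h (nodup_substVars hne (h₁ s) (h₂ s) hs)⟩

theorem replicate_length_substVars (x x₁ x₂ : V) (l : List V) (k : ℕ) :
    Multiset.replicate ((substVars x x₁ x₂ l).length - 1) k =
      Multiset.replicate (l.length - 1) k + Multiset.replicate (l.count x) k := by
  rw [length_substVars, ← Multiset.replicate_add]
  rcases l with _ | ⟨z, l⟩
  · rfl
  · congr 1; simp only [List.length_cons]; omega

/-- Substitution in the other constraints adds to the measure only ranks of sides on which the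
split variable occurs. -/
theorem exists_totalExcess_subst {x x₁ x₂ : V} {k : ℕ} {L : List (RankedSides V)}
    (h : ∀ b ∈ L, ∀ s, x ∈ b.word s → b.rank s < k) :
    ∃ m : Multiset ℕ, (∀ i ∈ m, i < k) ∧
      totalExcess (L.map (subst x x₁ x₂)) = totalExcess L + m := by
  induction L with
  | nil => exact ⟨0, by simp, rfl⟩
  | cons b L ih =>
    obtain ⟨m, hm, e⟩ := ih fun b hb => h b (List.mem_cons_of_mem _ hb)
    simp only [totalExcess, List.map_cons, List.sum_cons] at e ⊢
    refine ⟨Multiset.replicate ((b.word .left).count x) (b.rank .left) +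
      Multiset.replicate ((b.word .right).count x) (b.rank .right) + m, ?_, ?_⟩
    · intro i hi
      simp only [Multiset.mem_add] at hi
      rcases hi with (hi | hi) | hi
      · rw [Multiset.eq_of_mem_replicate hi]
        exact h b (by simp) _ (List.count_pos_iff.1
          (Nat.pos_of_ne_zero (Multiset.mem_replicate.1 hi).1))
      · rw [Multiset.eq_of_mem_replicate hi]
        exact h b (by simp) _ (List.count_pos_iff.1
          (Nat.pos_of_ne_zero (Multiset.mem_replicate.1 hi).1))
      · exact hm i hi
    · rw [e, excess, excess]
      simp only [subst, replicate_length_substVars]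
      abel

/-- The effect of a split on ranked sides. On side `s` of the split constraint `a` stands `x ∘ t`
and on the other side `y ∘ t'`; `f` and `g` are the two constraints that replace `a` when `x` is cut
into `x₁ ∘ x₂`. -/
structure IsSplit (a f g : RankedSides V) (s : Side) (x x₁ x₂ y : V) (t t' : List V) : Prop where
  word : a.word s = x :: t
  word_other : a.word s.other = y :: t'
  rank_fst : f.rank = a.rank
  rank_snd : g.rank = a.rank
  fst_word : f.word s = [x₁]
  fst_other : f.word s.other = [y]
  snd_word : g.word s = x₂ :: substVars x x₁ x₂ t
  snd_other : g.word s.other = t'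
  tail_ne : t' ≠ []

namespace IsSplit

variable {a f g : RankedSides V} {s : Side} {x x₁ x₂ y : V} {t t' : List V}

theorem refines_fst (h : IsSplit a f g s x x₁ x₂ y t t') (h₁ : ∀ s, x₁ ∉ a.word s)
    (h₂ : ∀ s, x₂ ∉ a.word s) : Refines (origin x x₁ x₂) f a := by
  refine ⟨h.rank_fst, fun s' z hz => ?_⟩
  rcases s.eq_or_eq_other s' with rfl | rfl
  · simp only [h.fst_word, List.mem_singleton] at hz
    simp [hz, origin, h.word]
  · simp only [h.fst_other, List.mem_singleton] at hz
    have hy : y ∈ a.word s.other := by simp [h.word_other]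
    subst hz
    rw [origin_eq_self (fun e => h₁ _ (e ▸ hy)) (fun e => h₂ _ (e ▸ hy))]
    exact hy

theorem refines_snd (h : IsSplit a f g s x x₁ x₂ y t t') (h₁ : ∀ s, x₁ ∉ a.word s)
    (h₂ : ∀ s, x₂ ∉ a.word s) : Refines (origin x x₁ x₂) g a := by
  refine ⟨h.rank_snd, fun s' z hz => ?_⟩
  rcases s.eq_or_eq_other s' with rfl | rfl
  · rw [h.snd_word, List.mem_cons] at hz
    have h₁' := h₁ s'
    have h₂' := h₂ s'
    rw [h.word] at h₁' h₂' ⊢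
    rcases hz with rfl | hz
    · simp [origin]
    · exact List.mem_cons_of_mem _ (origin_mem_of_mem_substVars
        (fun e => h₁' (List.mem_cons_of_mem _ e)) (fun e => h₂' (List.mem_cons_of_mem _ e)) hz)
  · rw [h.snd_other] at hz
    have hz' : z ∈ a.word s.other := by rw [h.word_other]; exact List.mem_cons_of_mem _ hz
    rw [origin_eq_self (fun e => h₁ _ (e ▸ hz')) (fun e => h₂ _ (e ▸ hz'))]
    exact hz'

theorem coherent_fst (h : IsSplit a f g s x x₁ x₂ y t t') (h₁ : ∀ s, x₁ ∉ a.word s)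
    (h₂ : ∀ s, x₂ ∉ a.word s) (ha : a.Coherent) : f.Coherent := by
  refine fun s' => ⟨(h.refines_fst h₁ h₂).disjoint ha s', fun hn => (hn ?_).elim⟩
  rcases s.eq_or_eq_other s' with rfl | rfl
  · simp [h.fst_word]
  · simp [h.fst_other]

theorem coherent_snd (h : IsSplit a f g s x x₁ x₂ y t t')
    (h₁ : ∀ s, x₁ ∉ a.word s) (h₂ : ∀ s, x₂ ∉ a.word s) (ha : a.Coherent) : g.Coherent := by
  refine fun s' => ⟨(h.refines_snd h₁ h₂).disjoint ha s', fun hn => ?_⟩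
  rw [h.rank_snd]
  refine (ha s').2 fun hd => hn ?_
  rcases s.eq_or_eq_other s' with rfl | rfl
  · have h₂' := h₂ s'
    rw [h.word] at hd h₂'
    rw [h.snd_word, substVars_eq_self (List.nodup_cons.1 hd).1, List.nodup_cons]
    exact ⟨fun e => h₂' (List.mem_cons_of_mem _ e), (List.nodup_cons.1 hd).2⟩
  · rw [h.word_other] at hd
    rw [h.snd_other]
    exact (List.nodup_cons.1 hd).2

/-- A common variable of the two new constraints comes from a variable that is repeated on one
side of the split constraint. -/
theorem compatible (h : IsSplit a f g s x x₁ x₂ y t t') (hne : x₁ ≠ x₂)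
    (h₁ : ∀ s, x₁ ∉ a.word s) (h₂ : ∀ s, x₂ ∉ a.word s) (ha : a.Coherent) : f.Compatible g := by
  have key : ∀ s' z, z ∈ f.word s' → z ∈ g.word s' → a.rank s' < a.rank s'.other := by
    intro s' z hf hg
    refine (ha s').2 fun hd => ?_
    rcases s.eq_or_eq_other s' with rfl | rfl
    · have h₁' := h₁ s'
      rw [h.word] at hd h₁'
      rw [h.fst_word, List.mem_singleton] at hf
      rw [h.snd_word, substVars_eq_self (List.nodup_cons.1 hd).1, hf, List.mem_cons] at hg
      exact hg.elim hne fun e => h₁' (List.mem_cons_of_mem _ e)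
    · rw [h.word_other] at hd
      rw [h.fst_other, List.mem_singleton] at hf
      rw [h.snd_other, hf] at hg
      exact (List.nodup_cons.1 hd).1 hg
  intro s₁ s₂ z hz₁ hz₂
  rw [h.rank_fst, h.rank_snd]
  rcases s₁.eq_or_eq_other s₂ with rfl | rfl
  · exact ⟨key _ z hz₁ hz₂, key _ z hz₁ hz₂⟩
  · exact ((ha s₁).1 _ ((h.refines_fst h₁ h₂).2 _ z hz₁)
      ((h.refines_snd h₁ h₂).2 _ z hz₂)).elim

/-- Replacing `a` removes one copy of the rank of the side opposite to the split variable. -/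
theorem exists_excess (h : IsSplit a f g s x x₁ x₂ y t t') (ha : a.Coherent) :
    ∃ m : Multiset ℕ, (∀ i ∈ m, i < a.rank s.other) ∧
      f.excess + g.excess + {a.rank s.other} = a.excess + m := by
  refine ⟨Multiset.replicate (t.count x) (a.rank s), fun i hi => ?_, ?_⟩
  · rw [Multiset.mem_replicate] at hi
    rw [hi.2]
    refine (ha s).2 fun hd => ?_
    rw [h.word, List.nodup_cons] at hd
    exact hd.1 (List.count_pos_iff.1 (Nat.pos_of_ne_zero hi.1))
  · obtain ⟨b, l, rfl⟩ := List.exists_cons_of_ne_nil h.tail_ne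
    rw [f.excess_eq s, g.excess_eq s, a.excess_eq s, h.word, h.word_other, h.fst_word, h.fst_other,
      h.snd_word, h.snd_other, h.rank_fst, h.rank_snd]
    simp only [List.length_cons, List.length_nil, Nat.add_sub_cancel, length_substVars,
      Multiset.replicate_add, Multiset.replicate_one, zero_add, Nat.sub_self,
      Multiset.replicate_zero]
    abel

end IsSplit

/-- Any split preserves the ranking and decreases the measure: it removes one copy of the rank of
the side opposite to the split variable, and adds copies of smaller ranks only. -/
theorem Ranking.split {L₁ L₂ : List (RankedSides V)} {a f g : RankedSides V} {s : Side}
    {x x₁ x₂ y : V} {t t' : List V} (hL : Ranking (L₁ ++ a :: L₂))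
    (h : IsSplit a f g s x x₁ x₂ y t t') (hne : x₁ ≠ x₂)
    (h₁ : ∀ b ∈ L₁ ++ a :: L₂, ∀ s, x₁ ∉ b.word s)
    (h₂ : ∀ b ∈ L₁ ++ a :: L₂, ∀ s, x₂ ∉ b.word s) :
    Ranking (L₁.map (subst x x₁ x₂) ++ f :: g :: L₂.map (subst x x₁ x₂)) ∧
    Relation.CutExpand (· < ·)
      (totalExcess (L₁.map (subst x x₁ x₂) ++ f :: g :: L₂.map (subst x x₁ x₂)))
      (totalExcess (L₁ ++ a :: L₂)) := by
  have p : (L₁ ++ a :: L₂).Perm (a :: (L₁ ++ L₂)) := List.perm_middle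
  have p' : (L₁.map (subst x x₁ x₂) ++ f :: g :: L₂.map (subst x x₁ x₂)).Perm
      (f :: g :: (L₁ ++ L₂).map (subst x x₁ x₂)) := by
    rw [List.map_append]
    exact List.perm_middle.trans (List.perm_middle.cons f)
  rw [totalExcess_perm p, totalExcess_perm p']
  suffices h : Ranking (f :: g :: (L₁ ++ L₂).map (subst x x₁ x₂)) ∧ Relation.CutExpand (· < ·)
      (totalExcess (f :: g :: (L₁ ++ L₂).map (subst x x₁ x₂))) (totalExcess (a :: (L₁ ++ L₂))) from
    ⟨h.1.perm p'.symm, h.2⟩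
  replace hL := hL.perm p
  replace h₁ := fun b hb => h₁ b (p.mem_iff.2 hb)
  replace h₂ := fun b hb => h₂ b (p.mem_iff.2 hb)
  generalize L₁ ++ L₂ = L at hL h₁ h₂ ⊢
  obtain ⟨hcoh, hpw⟩ := hL
  rw [List.pairwise_cons] at hpw
  rw [List.forall_mem_cons] at h₁ h₂ hcoh
  obtain ⟨ha₁, h₁⟩ := h₁
  obtain ⟨ha₂, h₂⟩ := h₂
  obtain ⟨hac, hcoh⟩ := hcoh
  have rf := h.refines_fst ha₁ ha₂
  have rg := h.refines_snd ha₁ ha₂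
  have rL : ∀ b ∈ L, Refines (origin x x₁ x₂) (b.subst x x₁ x₂) b :=
    fun b hb => refines_subst (h₁ b hb) (h₂ b hb)
  refine ⟨⟨?_, ?_⟩, ?_⟩
  · simp only [List.forall_mem_cons, List.forall_mem_map]
    exact ⟨h.coherent_fst ha₁ ha₂ hac, h.coherent_snd ha₁ ha₂ hac,
      fun b hb => coherent_subst hne (h₁ b hb) (h₂ b hb) (hcoh b hb)⟩
  · simp only [List.pairwise_cons, List.forall_mem_cons, List.forall_mem_map, List.pairwise_map]
    refine ⟨⟨h.compatible hne ha₁ ha₂ hac, fun b hb => rf.compatible (rL b hb) (hpw.1 b hb)⟩,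
      fun b hb => rg.compatible (rL b hb) (hpw.1 b hb), ?_⟩
    exact hpw.2.imp_of_mem fun {b b'} hb hb' hc => (rL b hb).compatible (rL b' hb') hc
  · obtain ⟨m, hm, e⟩ := h.exists_excess hac
    obtain ⟨m', hm', e'⟩ := exists_totalExcess_subst (x := x) (x₁ := x₁) (x₂ := x₂)
      (k := a.rank s.other) (L := L) fun b hb s' hx =>
        (hpw.1 b hb s s' x (by simp [h.word]) hx).1
    refine ⟨m + m', a.rank s.other, fun i hi => (Multiset.mem_add.1 hi).elim (hm i) (hm' i), ?_⟩
    simp only [totalExcess, List.map_cons, List.sum_cons] at e' ⊢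
    rw [e', ← add_assoc, add_right_comm, e]
    abel

end Subst

end RankedSides

/-! ### Rankings and the splitting graph -/

section Graph

variable {α : Type u} {V : Type v}

open RankedSides

theorem label_eq_some_iff {Γ : List (RelConstraint α V)} {p : Position} {z : V} :
    label Γ p = some z ↔ ∃ φ, Γ[p.con]? = some φ ∧ (φ.word p.side)[p.idx]? = some z := by
  simp [label, Option.bind_eq_some_iff, RelConstraint.word]

theorem isPosition_iff {Γ : List (RelConstraint α V)} {p : Position} :
    IsPosition Γ p ↔ ∃ φ, Γ[p.con]? = some φ ∧ p.idx < (φ.word p.side).length := by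
  rw [IsPosition, Option.isSome_iff_exists]
  simp only [label_eq_some_iff]
  constructor
  · rintro ⟨z, φ, h, h'⟩
    exact ⟨φ, h, (List.getElem?_eq_some_iff.1 h').1⟩
  · rintro ⟨φ, h, h'⟩
    exact ⟨_, φ, h, List.getElem?_eq_getElem h'⟩

/-- The list `L` equips the constraints of `Γ` with ranks. -/
def Ranks (L : List (RankedSides V)) (Γ : List (RelConstraint α V)) : Prop :=
  L.map RankedSides.word = Γ.map RelConstraint.word

/-- The rank of the side on which a position lies. -/
def rankAt (L : List (RankedSides V)) (p : Position) : ℕ :=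
  (L[p.con]?.map fun a => a.rank p.side).getD 0

theorem Ranks.getElem? {L : List (RankedSides V)} {Γ : List (RelConstraint α V)} (h : Ranks L Γ)
    {i : ℕ} {φ : RelConstraint α V} (hφ : Γ[i]? = some φ) :
    ∃ a, L[i]? = some a ∧ a.word = φ.word := by
  have := congrArg (fun l => l[i]?) h
  simp only [List.getElem?_map, hφ, Option.map_some, Option.map_eq_some_iff] at this
  exact this

theorem not_nodup_of_getElem? {l : List V} {i j : ℕ} {z : V} (hi : l[i]? = some z)
    (hj : l[j]? = some z) (hne : i ≠ j) : ¬ l.Nodup := fun h => by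
  obtain ⟨hi', -⟩ := List.getElem?_eq_some_iff.1 hi
  exact hne ((List.getElem?_inj hi' h).1 (hi.trans hj.symm))

/-- Ranks decrease along the edges of the splitting graph. -/
theorem rankAt_lt_of_edge {L : List (RankedSides V)} {Γ : List (RelConstraint α V)}
    (hL : Ranking L) (h : Ranks L Γ) {p p' : Position} (he : Edge Γ p p') :
    rankAt L p' < rankAt L p := by
  obtain ⟨hp, hp', q, hq, hne, ⟨hcon, hside⟩, hlab⟩ := he
  obtain ⟨z, hz'⟩ := Option.isSome_iff_exists.1 hp'
  have hz := hlab.trans hz'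
  obtain ⟨φ, hφ, hzφ⟩ := label_eq_some_iff.1 hz
  obtain ⟨ψ, hψ, hzψ⟩ := label_eq_some_iff.1 hz'
  obtain ⟨a, ha, haφ⟩ := h.getElem? hφ
  obtain ⟨b, hb, hbψ⟩ := h.getElem? hψ
  rw [← haφ] at hzφ
  rw [← hbψ] at hzψ
  have hps : p.side = q.side.other := by
    rcases q.side.eq_or_eq_other p.side with e | e
    · exact (hside e).elim
    · exact e
  have e : rankAt L p = a.rank q.side.other := by rw [rankAt, hcon, ha, ← hps]; rfl
  have e' : rankAt L p' = b.rank p'.side := by rw [rankAt, hb]; rfl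
  rw [e, e']
  have hm := List.mem_of_getElem? hzφ
  have hm' := List.mem_of_getElem? hzψ
  obtain ⟨hqL, haL⟩ := List.getElem?_eq_some_iff.1 ha
  obtain ⟨hpL, hbL⟩ := List.getElem?_eq_some_iff.1 hb
  rcases lt_trichotomy q.con p'.con with hlt | heq | hgt
  · have := List.pairwise_iff_getElem.1 hL.2 _ _ hqL hpL hlt
    rw [haL, hbL] at this
    exact (this _ _ z hm hm').1
  · have hab : a = b := by rw [heq, hb] at ha; exact (Option.some.inj ha).symm
    subst hab
    have hcoh := hL.1 a (List.mem_of_getElem? ha)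
    rcases q.side.eq_or_eq_other p'.side with e | e
    · rw [e] at hzψ ⊢
      refine (hcoh q.side).2 (not_nodup_of_getElem? hzφ hzψ fun hidx => hne ?_)
      exact Position.ext heq e.symm hidx
    · rw [e] at hm'
      exact ((hcoh q.side).1 z hm hm').elim
  · have := List.pairwise_iff_getElem.1 hL.2 _ _ hpL hqL hgt
    rw [haL, hbL] at this
    exact (this _ _ z hm' hm).2

theorem graphChainFree_of_ranking {L : List (RankedSides V)} {Γ : List (RelConstraint α V)}
    (hL : Ranking L) (h : Ranks L Γ) : GraphChainFree Γ := by
  have key : ∀ p p', Relation.TransGen (Edge Γ) p p' → rankAt L p' < rankAt L p := by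
    intro p p' hp
    induction hp with
    | single he => exact rankAt_lt_of_edge hL h he
    | tail _ he ih => exact (rankAt_lt_of_edge hL h he).trans ih
  exact fun p hp => lt_irrefl _ (key p p hp)

/-- The side of largest rank consists of root nodes. -/
theorem exists_isRootConstraint {L : List (RankedSides V)} {Γ : List (RelConstraint α V)}
    (hL : Ranking L) (h : Ranks L Γ) (hne : Γ ≠ []) : ∃ j, IsRootConstraint Γ j := by
  obtain ⟨j, hj, hmax⟩ := Finset.exists_max_image (Finset.range Γ.length)
    (fun j => max (rankAt L ⟨j, .left, 0⟩) (rankAt L ⟨j, .right, 0⟩))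
    ⟨0, Finset.mem_range.2 (List.length_pos_iff.2 hne)⟩
  rw [Finset.mem_range] at hj
  obtain ⟨s, hs⟩ : ∃ s : Side, max (rankAt L ⟨j, .left, 0⟩) (rankAt L ⟨j, .right, 0⟩) =
      rankAt L ⟨j, s, 0⟩ := by
    rcases max_choice (rankAt L ⟨j, .left, 0⟩) (rankAt L ⟨j, .right, 0⟩) with e | e
    · exact ⟨_, e⟩
    · exact ⟨_, e⟩
  refine ⟨j, hj, s, fun p hp hpj hps => ⟨hp, fun q he => ?_⟩⟩
  have hlt := rankAt_lt_of_edge hL h he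
  obtain ⟨φ, hφ, -⟩ := isPosition_iff.1 he.1
  have := hmax q.con (Finset.mem_range.2 (List.getElem?_eq_some_iff.1 hφ).1)
  rw [hs] at this
  have e : rankAt L p = rankAt L ⟨j, s, 0⟩ := by rw [rankAt, rankAt, hpj, hps]
  have e' : rankAt L q ≤ max (rankAt L ⟨q.con, .left, 0⟩) (rankAt L ⟨q.con, .right, 0⟩) := by
    obtain ⟨i, t, k⟩ := q
    cases t
    · exact le_max_left _ _
    · exact le_max_right _ _
  omega

theorem finite_isPosition (Γ : List (RelConstraint α V)) : {p | IsPosition Γ p}.Finite := by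
  let n := Γ.length
  obtain ⟨m, hm⟩ : ∃ m, ∀ φ ∈ Γ, ∀ s, (φ.word s).length ≤ m := by
    refine ⟨(Γ.map fun φ => (φ.word .left).length + (φ.word .right).length).sum, fun φ hφ s => ?_⟩
    have := List.single_le_sum (l := Γ.map fun φ => (φ.word .left).length +
      (φ.word .right).length) (by simp) _ (List.mem_map.2 ⟨φ, hφ, rfl⟩)
    cases s <;> omega
  refine (((Set.finite_lt_nat n).prod ((Set.toFinite ({.left, .right} : Set Side)).prod
    (Set.finite_lt_nat m))).image fun x => Position.mk x.1 x.2.1 x.2.2).subset ?_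
  intro p hp
  obtain ⟨φ, hφ, hlt⟩ := isPosition_iff.1 hp
  obtain ⟨hn, e⟩ := List.getElem?_eq_some_iff.1 hφ
  refine ⟨⟨p.con, p.side, p.idx⟩, ⟨hn, ?_, ?_⟩, rfl⟩
  · rcases p with ⟨_, s, _⟩
    cases s <;> simp
  · exact hlt.trans_le (hm φ (e ▸ List.getElem_mem hn) _)

/-- The positions reachable from a position by a nonempty sequence of edges. -/
def reachable (Γ : List (RelConstraint α V)) (p : Position) : Set Position :=
  {q | Relation.TransGen (Edge Γ) p q}

theorem finite_reachable (Γ : List (RelConstraint α V)) (p : Position) :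
    (reachable Γ p).Finite := by
  refine (finite_isPosition Γ).subset fun q hq => ?_
  obtain ⟨r, -, h⟩ := Relation.TransGen.tail'_iff.1 hq
  exact h.2.1

/-- The outgoing edges of a position depend only on the side on which it lies. -/
theorem edge_congr_left {Γ : List (RelConstraint α V)} {p q r : Position} (hq : IsPosition Γ q)
    (hc : q.con = p.con) (hs : q.side = p.side) (h : Edge Γ p r) : Edge Γ q r := by
  obtain ⟨-, hr, x, hx, hne, ⟨h₁, h₂⟩, hl⟩ := h
  exact ⟨hq, hr, x, hx, hne, ⟨hc.trans h₁, hs ▸ h₂⟩, hl⟩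

/-- In a chain-free graph, the number of positions that can be reached decreases along edges. -/
theorem ncard_reachable_lt {Γ : List (RelConstraint α V)} (hΓ : GraphChainFree Γ)
    {p q r : Position} (h : Edge Γ p q) (hc : q.con = r.con) (hs : q.side = r.side) :
    (reachable Γ r).ncard < (reachable Γ p).ncard := by
  refine Set.ncard_lt_ncard ⟨fun x hx => ?_, fun hsub => ?_⟩ (finite_reachable Γ p)
  · obtain ⟨y, hy, hyx⟩ := Relation.TransGen.head'_iff.1 hx
    exact .head' h (.head (edge_congr_left h.2.1 hc hs hy) hyx)
  · have hx : Relation.TransGen (Edge Γ) r q := hsub (.single h)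
    obtain ⟨y, hy, hyx⟩ := Relation.TransGen.head'_iff.1 hx
    exact hΓ q (.head' (edge_congr_left h.2.1 hc hs hy) hyx)

theorem isPosition_zero {Γ : List (RelConstraint α V)} {i : ℕ} (hi : i < Γ.length) (s : Side) :
    IsPosition Γ ⟨i, s, 0⟩ :=
  isPosition_iff.2 ⟨Γ[i], List.getElem?_eq_getElem hi, by simp [RelConstraint.word, StrTerm.toList]⟩

/-- The constraints of `Γ`, ranked by the number of positions that can be reached. -/
noncomputable def reachRanks (Γ : List (RelConstraint α V)) : List (RankedSides V) :=
  Γ.mapIdx fun i φ => ⟨φ.word, fun s => (reachable Γ ⟨i, s, 0⟩).ncard⟩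

theorem ranks_reachRanks (Γ : List (RelConstraint α V)) : Ranks (reachRanks Γ) Γ := by
  refine List.ext_getElem (by simp [reachRanks]) fun i h h' => ?_
  simp [reachRanks]

theorem reachable_lt_of_occurrences {Γ : List (RelConstraint α V)} (hΓ : GraphChainFree Γ)
    {i j k l : ℕ} {s t : Side} {z : V} (hi : i < Γ.length) (hj : j < Γ.length)
    (hz : (Γ[i].word s)[k]? = some z) (hz' : (Γ[j].word t)[l]? = some z)
    (hne : (⟨i, s, k⟩ : Position) ≠ ⟨j, t, l⟩) :
    (reachable Γ ⟨j, t, 0⟩).ncard < (reachable Γ ⟨i, s.other, 0⟩).ncard := by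
  have l₁ : label Γ ⟨i, s, k⟩ = some z :=
    label_eq_some_iff.2 ⟨_, List.getElem?_eq_getElem hi, hz⟩
  have l₂ : label Γ ⟨j, t, l⟩ = some z :=
    label_eq_some_iff.2 ⟨_, List.getElem?_eq_getElem hj, hz'⟩
  refine ncard_reachable_lt hΓ (q := ⟨j, t, l⟩) ⟨isPosition_zero hi _, ?_, ⟨i, s, k⟩, ?_, hne,
    ⟨rfl, s.other_ne⟩, l₁.trans l₂.symm⟩ rfl rfl
  · rw [IsPosition, l₂]; rfl
  · rw [IsPosition, l₁]; rfl

theorem ranking_reachRanks {Γ : List (RelConstraint α V)} (hΓ : GraphChainFree Γ) :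
    Ranking (reachRanks Γ) := by
  constructor
  · intro a ha
    obtain ⟨i, hi, rfl⟩ := List.mem_mapIdx.1 ha
    refine fun s => ⟨fun z hz hz' => ?_, fun hd => ?_⟩
    · -- the second occurrence of `z` would have an edge to itself
      obtain ⟨k, hk⟩ := List.getElem?_of_mem hz
      obtain ⟨l, hl⟩ := List.getElem?_of_mem hz'
      have := reachable_lt_of_occurrences hΓ hi hi hk hl fun e =>
        s.other_ne (congrArg Position.side e).symm
      exact lt_irrefl _ this
    · obtain ⟨k, l, hk, hl, hne, e⟩ : ∃ k l, ∃ (hk : k < (Γ[i].word s).length)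
          (hl : l < (Γ[i].word s).length), k < l ∧ (Γ[i].word s)[k] = (Γ[i].word s)[l] := by
        simpa [List.Nodup, List.pairwise_iff_getElem] using hd
      exact reachable_lt_of_occurrences hΓ hi hi (List.getElem?_eq_getElem hk)
        (by rw [List.getElem?_eq_getElem hl, e]) fun e' => hne.ne (congrArg Position.idx e')
  · rw [List.pairwise_iff_getElem]
    intro i j hi hj hij s t z hz hz'
    simp only [reachRanks, List.getElem_mapIdx] at hz hz' ⊢
    simp only [reachRanks, List.length_mapIdx] at hi hj
    obtain ⟨k, hk⟩ := List.getElem?_of_mem hz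
    obtain ⟨l, hl⟩ := List.getElem?_of_mem hz'
    exact ⟨reachable_lt_of_occurrences hΓ hi hj hk hl fun e => hij.ne (congrArg Position.con e),
      reachable_lt_of_occurrences hΓ hj hi hl hk fun e => hij.ne' (congrArg Position.con e)⟩

/-! ### The termination measure -/

/-- Some ranking of the constraints of `Γ` has the total excess `M`. -/
def HasMeasure (Γ : List (RelConstraint α V)) (M : Multiset ℕ) : Prop :=
  ∃ L, Ranks L Γ ∧ Ranking L ∧ totalExcess L = M

theorem graphChainFree_iff {Γ : List (RelConstraint α V)} :
    GraphChainFree Γ ↔ ∃ M, HasMeasure Γ M :=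
  ⟨fun h => ⟨_, _, ranks_reachRanks Γ, ranking_reachRanks h, rfl⟩,
    fun ⟨_, _, h, hL, _⟩ => graphChainFree_of_ranking hL h⟩

theorem Ranks.exists_append_cons {L : List (RankedSides V)} {Γ₁ Γ₂ : List (RelConstraint α V)}
    {φ : RelConstraint α V} (h : Ranks L (Γ₁ ++ φ :: Γ₂)) :
    ∃ L₁ a L₂, L = L₁ ++ a :: L₂ ∧ Ranks L₁ Γ₁ ∧ a.word = φ.word ∧ Ranks L₂ Γ₂ := by
  rw [Ranks, List.map_append, List.map_cons] at h
  obtain ⟨L₁, L', rfl, h₁, h'⟩ := List.map_eq_append_iff.1 h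
  obtain ⟨a, L₂, rfl, ha, h₂⟩ := List.map_eq_cons_iff.1 h'
  exact ⟨L₁, a, L₂, rfl, h₁, ha, h₂⟩

theorem Ranks.append {L₁ L₂ : List (RankedSides V)} {Γ₁ Γ₂ : List (RelConstraint α V)}
    (h₁ : Ranks L₁ Γ₁) (h₂ : Ranks L₂ Γ₂) : Ranks (L₁ ++ L₂) (Γ₁ ++ Γ₂) := by
  rw [Ranks, List.map_append, List.map_append, h₁, h₂]

theorem Ranks.cons {L : List (RankedSides V)} {Γ : List (RelConstraint α V)} {a : RankedSides V}
    {φ : RelConstraint α V} (ha : a.word = φ.word) (h : Ranks L Γ) : Ranks (a :: L) (φ :: Γ) := by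
  rw [Ranks, List.map_cons, List.map_cons, h, ha]

theorem HasMeasure.move {Γ₁ Γ₂ Δ : List (RelConstraint α V)} {φ : RelConstraint α V}
    {M : Multiset ℕ} (h : HasMeasure (Γ₁ ++ φ :: Γ₂ ++ Δ) M) :
    HasMeasure (Γ₁ ++ Γ₂ ++ φ :: Δ) M := by
  obtain ⟨L, h, hL, rfl⟩ := h
  rw [List.append_assoc, List.cons_append] at h
  obtain ⟨L₁, a, L', rfl, h₁, ha, h'⟩ := h.exists_append_cons
  rw [Ranks, List.map_append] at h'
  obtain ⟨L₂, K, rfl, h₂, hK⟩ := List.map_eq_append_iff.1 h'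
  have p : (L₁ ++ a :: (L₂ ++ K)).Perm (L₁ ++ L₂ ++ a :: K) := by
    rw [List.append_assoc]
    exact List.perm_middle.symm.append_left L₁
  exact ⟨_, (Ranks.append h₁ h₂).append (Ranks.cons ha hK), hL.perm p, (totalExcess_perm p).symm⟩

theorem HasMeasure.exists_root {Γ Δ : List (RelConstraint α V)} {M : Multiset ℕ}
    (h : HasMeasure (Γ ++ Δ) M) (hne : Γ ≠ []) : ∃ j, IsRootConstraint Γ j := by
  obtain ⟨L, h, hL, -⟩ := h
  rw [Ranks, List.map_append] at h
  obtain ⟨L₁, L₂, rfl, h₁, -⟩ := List.map_eq_append_iff.1 h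
  exact exists_isRootConstraint (hL.sublist (List.sublist_append_left L₁ L₂)) h₁ hne

theorem RelConstraint.mem_vars_of_mem_word {φ : RelConstraint α V} {s : Side} {z : V}
    (h : z ∈ φ.word s) : z ∈ φ.vars := by
  cases s
  · exact List.mem_append_left _ h
  · exact List.mem_append_right _ h

theorem Ranks.exists_of_mem {L : List (RankedSides V)} {Γ : List (RelConstraint α V)}
    (h : Ranks L Γ) {a : RankedSides V} (ha : a ∈ L) : ∃ φ ∈ Γ, φ.word = a.word := by
  have : a.word ∈ L.map RankedSides.word := List.mem_map_of_mem ha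
  rw [h] at this
  exact List.mem_map.1 this

section Split

variable [DecidableEq V]

theorem RelConstraint.word_subst (x x₁ x₂ : V) (φ : RelConstraint α V) (s : Side) :
    (φ.subst x x₁ x₂).word s = substVars x x₁ x₂ (φ.word s) := by
  cases s <;> exact StrTerm.toList_subst ..

theorem Ranks.subst {L : List (RankedSides V)} {Γ : List (RelConstraint α V)} (h : Ranks L Γ)
    (x x₁ x₂ : V) :
    Ranks (L.map (RankedSides.subst x x₁ x₂)) (Γ.map (RelConstraint.subst x x₁ x₂)) := by
  have e := congrArg (List.map fun w s => substVars x x₁ x₂ (w s)) h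
  rw [List.map_map, List.map_map] at e
  rw [Ranks, List.map_map, List.map_map]
  refine Eq.trans e (List.map_congr_left fun φ _ => ?_)
  funext s
  exact (φ.word_subst x x₁ x₂ s).symm

/-- The disjuncts of a split are splits of ranked sides. -/
theorem RelConstraint.exists_isSplit {φ : RelConstraint α V} {x₁ x₂ y₁ y₂ : V}
    {c : SplitCase α V} (hc : c ∈ φ.split x₁ x₂ y₁ y₂) {a : RankedSides V} (ha : a.Coherent)
    (hw : a.word = φ.word) (h₁ : ∀ s, c.x₁ ∉ a.word s) (h₂ : ∀ s, c.x₂ ∉ a.word s) :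
    ∃ s y t t', IsSplit a ⟨c.fst.word, a.rank⟩ ⟨c.snd.word, a.rank⟩ s c.x c.x₁ c.x₂ y t t' := by
  rw [hw] at h₁ h₂
  have hdis := (ha .left).1
  rw [hw] at hdis
  obtain ⟨R, ⟨x, t⟩, ⟨y, t'⟩⟩ := φ
  have hdis' : ∀ z ∈ x :: t, z ∉ y :: t' := hdis
  rw [split, List.mem_append] at hc
  rcases hc with hc | hc
  · obtain ⟨b, l, rfl, R', -, rfl⟩ := mem_leftSplit.1 hc
    dsimp only at h₁ h₂ ⊢
    have e₁ : x₁ ≠ x := fun h => h₁ .left (h ▸ List.mem_cons_self)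
    have e₂ : x₂ ≠ x := fun h => h₂ .left (h ▸ List.mem_cons_self)
    have hx := hdis' x (by simp)
    have hy : x ∉ [y] := fun h => hx (by simp at h; simp [h])
    refine ⟨.left, y, t, b :: l, by rw [hw]; rfl, by rw [hw]; rfl, rfl, rfl, ?_, ?_, ?_, ?_,
      by simp⟩
    · exact (StrTerm.toList_subst ..).trans (substVars_eq_self (by simpa [StrTerm.toList, StrTerm.var] using e₁.symm))
    · exact (StrTerm.toList_subst ..).trans (substVars_eq_self hy)
    · refine (StrTerm.toList_subst ..).trans ?_
      simp [StrTerm.toList, substVars, e₂]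
    · exact (StrTerm.toList_subst ..).trans
        (substVars_eq_self fun h => hx (List.mem_cons_of_mem _ h))
  · obtain ⟨b, l, rfl, R', -, rfl⟩ := mem_rightSplit.1 hc
    dsimp only at h₁ h₂ ⊢
    have e₁ : y₁ ≠ y := fun h => h₁ .right (h ▸ List.mem_cons_self)
    have e₂ : y₂ ≠ y := fun h => h₂ .right (h ▸ List.mem_cons_self)
    have hy : y ∉ x :: b :: l := fun h => hdis' y h (by simp)
    have hx : y ∉ [x] := fun h => hy (by simp at h; simp [h])
    refine ⟨.right, x, t', b :: l, by rw [hw]; rfl, by rw [hw]; rfl, rfl, rfl, ?_, ?_, ?_, ?_,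
      by simp⟩
    · exact (StrTerm.toList_subst ..).trans (substVars_eq_self (by simpa [StrTerm.toList, StrTerm.var] using e₁.symm))
    · exact (StrTerm.toList_subst ..).trans (substVars_eq_self hx)
    · refine (StrTerm.toList_subst ..).trans ?_
      simp [StrTerm.toList, substVars, e₂]
    · exact (StrTerm.toList_subst ..).trans
        (substVars_eq_self fun h => hy (List.mem_cons_of_mem _ h))

theorem RelConstraint.newVars_of_mem_split {φ : RelConstraint α V} {x₁ x₂ y₁ y₂ : V}
    {c : SplitCase α V} (hc : c ∈ φ.split x₁ x₂ y₁ y₂) :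
    c.x₁ = x₁ ∧ c.x₂ = x₂ ∨ c.x₁ = y₁ ∧ c.x₂ = y₂ := by
  rw [split, List.mem_append] at hc
  rcases hc with hc | hc
  · obtain ⟨_, _, -, _, -, rfl⟩ := mem_leftSplit.1 hc
    exact .inl ⟨rfl, rfl⟩
  · obtain ⟨_, _, -, _, -, rfl⟩ := mem_rightSplit.1 hc
    exact .inr ⟨rfl, rfl⟩

/-- Every splitting step on a chain-free clause decreases the measure. -/
theorem HasMeasure.split {Γ₁ Γ₂ : List (RelConstraint α V)} {φ : RelConstraint α V}
    {side : List (SideLiteral α V)} {x₁ x₂ y₁ y₂ : V} {M : Multiset ℕ}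
    (h : HasMeasure (Γ₁ ++ φ :: Γ₂) M) (hfresh : FreshFor ⟨Γ₁ ++ φ :: Γ₂, side⟩ x₁ x₂ y₁ y₂)
    {c : SplitCase α V} (hc : c ∈ φ.split x₁ x₂ y₁ y₂) :
    ∃ M', HasMeasure (c.newRels Γ₁ Γ₂) M' ∧ Relation.CutExpand (· < ·) M' M := by
  obtain ⟨L, h, hL, rfl⟩ := h
  obtain ⟨hnd, hf⟩ := hfresh
  simp only [List.mem_cons, List.not_mem_nil, or_false, forall_eq_or_imp, forall_eq] at hf
  obtain ⟨hx₁, hx₂, hy₁, hy₂⟩ := hf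
  have hnew := RelConstraint.newVars_of_mem_split hc
  have hne : c.x₁ ≠ c.x₂ := by
    rcases hnew with ⟨h, h'⟩ | ⟨h, h'⟩ <;> rw [h, h'] <;> simp at hnd <;> tauto
  have hc₁ : c.x₁ ∉ (Clause.mk (Γ₁ ++ φ :: Γ₂) side).vars := by
    rcases hnew with ⟨h, -⟩ | ⟨h, -⟩ <;> rw [h] <;> assumption
  have hc₂ : c.x₂ ∉ (Clause.mk (Γ₁ ++ φ :: Γ₂) side).vars := by
    rcases hnew with ⟨-, h⟩ | ⟨-, h⟩ <;> rw [h] <;> assumption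
  have hfr : ∀ z, z ∉ (Clause.mk (Γ₁ ++ φ :: Γ₂) side).vars → ∀ b ∈ L, ∀ s, z ∉ b.word s := by
    intro z hz b hb s hzb
    obtain ⟨ψ, hψ, e⟩ := h.exists_of_mem hb
    exact hz (Clause.vars_subset_of_mem hψ (RelConstraint.mem_vars_of_mem_word (e ▸ hzb)))
  have h₁ := hfr _ hc₁
  have h₂ := hfr _ hc₂
  obtain ⟨L₁, a, L₂, rfl, hr₁, ha, hr₂⟩ := h.exists_append_cons
  obtain ⟨s, y, t, t', hs⟩ := RelConstraint.exists_isSplit hc (hL.1 a (by simp)) ha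
    (h₁ a (by simp)) (h₂ a (by simp))
  obtain ⟨hL', hlt⟩ := hL.split hs hne h₁ h₂
  exact ⟨_, ⟨_, (hr₁.subst ..).append (.cons rfl (.cons rfl (hr₂.subst ..))), hL', rfl⟩, hlt⟩

end Split

end Graph

/-! ### Runs of the splitting algorithm -/

section Algorithm

variable {α : Type u} {V : Type v}

namespace AnnClause

/-- No concatenation-free root constraint is left in the reminder. -/
def Reduced (a : AnnClause α V) : Prop := ∀ b, ¬ DropStep a b

theorem exists_dropsTo (a : AnnClause α V) : ∃ b, DropsTo a b := by
  induction h : a.reminder.length using Nat.strong_induction_on generalizing a with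
  | _ n ih =>
    by_cases hd : ∃ b, DropStep a b
    · obtain ⟨b, hb⟩ := hd
      obtain ⟨c, hc⟩ := ih b.reminder.length (by cases hb; simp [← h]) b rfl
      exact ⟨c, .head hb hc.1, hc.2⟩
    · exact ⟨a, .refl, not_exists.1 hd⟩

theorem DropsTo.hasMeasure {a b : AnnClause α V} (h : DropsTo a b) {M : Multiset ℕ}
    (ha : HasMeasure a.toClause.rels M) : HasMeasure b.toClause.rels M := by
  obtain ⟨h, -⟩ := h
  induction h with
  | refl => exact ha
  | tail _ h ih => cases h; exact ih.move

theorem DropsTo.holds_iff {a b : AnnClause α V} (h : DropsTo a b) (η : V → List α) :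
    b.toClause.Holds η ↔ a.toClause.Holds η := by
  obtain ⟨h, -⟩ := h
  induction h with
  | refl => rfl
  | tail _ h ih =>
    rw [← ih]
    cases h
    refine and_congr (forall_congr' fun ψ => imp_congr_left ?_) Iff.rfl
    simp only [toClause, List.mem_append, List.mem_cons]
    tauto

/-- A reminder that is not empty has a root constraint, since its graph is chain-free; and no root
constraint of a reduced reminder is concatenation-free. -/
theorem Reduced.exists_root {a : AnnClause α V} (h : a.Reduced) {M : Multiset ℕ}
    (ha : HasMeasure a.toClause.rels M) (hcf : ¬ a.ReminderConcatFree) :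
    ∃ Γ₁ φ Γ₂, a.reminder = Γ₁ ++ φ :: Γ₂ ∧ IsRootConstraint a.reminder Γ₁.length ∧
      ¬ φ.ConcatFree := by
  have hne : a.reminder ≠ [] := fun e => hcf (by simp [ReminderConcatFree, e])
  obtain ⟨j, hj⟩ := ha.exists_root hne
  obtain ⟨Γ, Δ, side⟩ := a
  obtain ⟨Γ₁, φ, Γ₂, rfl, rfl⟩ : ∃ Γ₁ φ Γ₂, Γ = Γ₁ ++ φ :: Γ₂ ∧ Γ₁.length = j := by
    refine ⟨Γ.take j, Γ[j]'hj.1, Γ.drop (j + 1), ?_, ?_⟩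
    · simp
    · simpa using hj.1.le
  exact ⟨Γ₁, φ, Γ₂, rfl, hj, fun hφ => h _ (.drop Γ₁ φ Γ₂ Δ side hj hφ)⟩

theorem toClause_splitChild [DecidableEq V] (a : AnnClause α V)
    (Γ₁ Γ₂ : List (RelConstraint α V)) (c : SplitCase α V) :
    (a.splitChild Γ₁ Γ₂ c).toClause = c.child Γ₁ (Γ₂ ++ a.dropped) a.side := by
  simp [splitChild, toClause, SplitCase.child, SplitCase.newRels]

end AnnClause

open AnnClause

theorem exists_of_forall₂_right {A B : Type*} {R : A → B → Prop} {l : List A} {l' : List B}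
    (h : List.Forall₂ R l l') : ∀ b ∈ l', ∃ a ∈ l, R a b := by
  induction h with
  | nil => simp
  | cons hab _ ih =>
    rw [List.forall_mem_cons]
    exact ⟨⟨_, List.mem_cons_self, hab⟩, fun b hb =>
      (ih b hb).imp fun _ h => ⟨List.mem_cons_of_mem _ h.1, h.2⟩⟩

theorem exists_of_forall₂_left {A B : Type*} {R : A → B → Prop} {l : List A} {l' : List B}
    (h : List.Forall₂ R l l') : ∀ a ∈ l, ∃ b ∈ l', R a b :=
  exists_of_forall₂_right (R := fun b a => R a b) h.flip

theorem exists_forall₂ {A B : Type*} {R : A → B → Prop} (h : ∀ a, ∃ b, R a b) (l : List A) :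
    ∃ l', List.Forall₂ R l l' := by
  choose f hf using h
  exact ⟨l.map f, by simp [List.forall₂_map_right_iff, List.forall₂_same, hf]⟩

theorem exists_holds_iff_of_forall₂ {l S : List (AnnClause α V)}
    (h : List.Forall₂ DropsTo l S) (η : V → List α) :
    (∃ b ∈ S, b.toClause.Holds η) ↔ ∃ a ∈ l, a.toClause.Holds η := by
  constructor
  · rintro ⟨b, hb, hη⟩
    obtain ⟨a, ha, hab⟩ := exists_of_forall₂_right h b hb
    exact ⟨a, ha, (hab.holds_iff η).1 hη⟩
  · rintro ⟨a, ha, hη⟩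
    obtain ⟨b, hb, hab⟩ := exists_of_forall₂_left h a ha
    exact ⟨b, hb, (hab.holds_iff η).2 hη⟩

theorem exists_freshFor [Infinite V] (C : Clause α V) :
    ∃ x₁ x₂ y₁ y₂, FreshFor C x₁ x₂ y₁ y₂ := by
  classical
  have key : ∀ l : List V, ∃ z, z ∉ l := fun l => by
    simpa using Infinite.exists_notMem_finset l.toFinset
  obtain ⟨x₁, h₁⟩ := key C.vars
  obtain ⟨x₂, h₂⟩ := key (x₁ :: C.vars)
  obtain ⟨y₁, h₃⟩ := key (x₂ :: x₁ :: C.vars)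
  obtain ⟨y₂, h₄⟩ := key (y₁ :: x₂ :: x₁ :: C.vars)
  simp only [List.mem_cons, not_or] at h₂ h₃ h₄
  refine ⟨x₁, x₂, y₁, y₂, ?_, ?_⟩
  · simp only [List.nodup_cons, List.mem_cons, List.not_mem_nil, or_false, not_or]
    tauto
  · simp only [List.mem_cons, List.not_mem_nil, or_false, forall_eq_or_imp, forall_eq]
    tauto

theorem satisfiable_map_iff {X : Type*} {f : X → Clause α V} {D : List X} :
    DNF.Satisfiable (D.map f) ↔ ∃ C ∈ D, ∃ η : V → List α, (f C).Holds η := by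
  simp only [DNF.Satisfiable, List.mem_map, exists_exists_and_eq_and]
  exact ⟨fun ⟨η, C, hC, h⟩ => ⟨C, hC, η, h⟩, fun ⟨C, hC, η, h⟩ => ⟨η, C, hC, h⟩⟩

theorem exists_mem_replace_iff {X : Type*} {p : X → Prop} {D₁ D₂ news : List X} {C : X}
    (h : p C ↔ ∃ C' ∈ news, p C') :
    (∃ C' ∈ D₁ ++ news ++ D₂, p C') ↔ ∃ C' ∈ D₁ ++ C :: D₂, p C' := by
  simp only [List.mem_append, List.mem_cons, or_and_right, exists_or, exists_eq_left, h]
  exact or_assoc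

/-! ### Termination -/

/-- The measures of the clauses of a disjunction, where `g` selects the relational constraints of
a clause. -/
def HasMeasures {X : Type*} (g : X → List (RelConstraint α V)) (D : List X)
    (N : Multiset (Multiset ℕ)) : Prop :=
  Multiset.Rel (fun C M => HasMeasure (g C) M) (D : Multiset X) N

/-- The order on the measures of clauses: remove one number, and add finitely many smaller ones. -/
abbrev ClauseLT : Multiset ℕ → Multiset ℕ → Prop := Relation.CutExpand (· < ·)

theorem wellFounded_clauseLT : WellFounded ClauseLT := Nat.lt_wfRel.wf.cutExpand

theorem exists_hasMeasures {X : Type*} {g : X → List (RelConstraint α V)} {D : List X}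
    (h : ∀ C ∈ D, ∃ M, HasMeasure (g C) M) : ∃ N, HasMeasures g D N := by
  choose! f hf using h
  refine ⟨(D : Multiset X).map f, Multiset.rel_map_right.2 (Multiset.rel_refl_of_refl_on ?_)⟩
  exact fun C hC => hf C hC

/-- Replacing a clause by finitely many clauses of smaller measure decreases the multiset of
measures. -/
theorem HasMeasures.replace {X : Type*} {g : X → List (RelConstraint α V)} {D₁ D₂ news : List X}
    {C : X} {N : Multiset (Multiset ℕ)} (h : HasMeasures g (D₁ ++ C :: D₂) N)
    (hnew : ∀ M, HasMeasure (g C) M → ∀ C' ∈ news, ∃ M', HasMeasure (g C') M' ∧ ClauseLT M' M) :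
    ∃ N', HasMeasures g (D₁ ++ news ++ D₂) N' ∧ Relation.CutExpand ClauseLT N' N := by
  rw [HasMeasures, Multiset.coe_eq_coe.2 (List.perm_middle (a := C) (l₁ := D₁) (l₂ := D₂)),
    ← Multiset.cons_coe, Multiset.rel_cons_left] at h
  obtain ⟨M, N, hM, hN, rfl⟩ := h
  have hnew := hnew M hM
  choose! f hf using hnew
  refine ⟨N + (news : Multiset X).map f, ?_, (news : Multiset X).map f, M, ?_, ?_⟩
  · have e : ((D₁ ++ news ++ D₂ : List X) : Multiset X) = ↑(D₁ ++ D₂) + ↑news := by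
      simp only [← Multiset.coe_add]
      abel
    rw [HasMeasures, e]
    exact hN.add (Multiset.rel_map_right.2 (Multiset.rel_refl_of_refl_on fun C hC => (hf C hC).1))
  · intro M' hM'
    obtain ⟨C', hC', rfl⟩ := Multiset.mem_map.1 hM'
    exact (hf C' hC').2
  · rw [← Multiset.singleton_add]
    abel

variable [DecidableEq V]

theorem HasMeasures.acc_phase2 {D : DNF α V} {N : Multiset (Multiset ℕ)}
    (h : HasMeasures Clause.rels D N) : Acc (fun s s' => AlgStep s' s) (AlgState.phase2 D) := by
  induction N using wellFounded_clauseLT.cutExpand.induction generalizing D with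
  | _ N ih =>
    refine ⟨_, fun s hs => ?_⟩
    cases hs with
    | split2 D₁ D₂ Γ₁ Γ₂ φ side x₁ x₂ y₁ y₂ hφ hfresh =>
      obtain ⟨N', hN', hlt⟩ := h.replace
        (news := (φ.split x₁ x₂ y₁ y₂).map fun c => c.child Γ₁ Γ₂ side) fun M hM C' hC' => by
          obtain ⟨c, hc, rfl⟩ := List.mem_map.1 hC'
          exact hM.split hfresh hc
      exact ih N' hlt hN'

/-- The clauses that replace `a` in a splitting step of the first phase have smaller measures. -/
theorem exists_hasMeasure_of_split1 {a b : AnnClause α V} {S : List (AnnClause α V)}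
    {Γ₁ Γ₂ : List (RelConstraint α V)} {φ : RelConstraint α V} {x₁ x₂ y₁ y₂ : V}
    (ha : a.reminder = Γ₁ ++ φ :: Γ₂) (hfresh : FreshFor a.toClause x₁ x₂ y₁ y₂)
    (hS : List.Forall₂ DropsTo ((φ.split x₁ x₂ y₁ y₂).map (a.splitChild Γ₁ Γ₂)) S)
    {M : Multiset ℕ} (hM : HasMeasure a.toClause.rels M) (hb : b ∈ S) :
    ∃ M', HasMeasure b.toClause.rels M' ∧ ClauseLT M' M := by
  obtain ⟨a', ha', hab⟩ := exists_of_forall₂_right hS b hb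
  obtain ⟨c, hc, rfl⟩ := List.mem_map.1 ha'
  have e : a.toClause = ⟨Γ₁ ++ φ :: (Γ₂ ++ a.dropped), a.side⟩ := by simp [toClause, ha]
  rw [e] at hfresh hM
  obtain ⟨M', hM', hlt⟩ := hM.split hfresh hc
  refine ⟨M', hab.hasMeasure ?_, hlt⟩
  rwa [toClause_splitChild]

theorem HasMeasures.acc_phase1 {S : List (AnnClause α V)} {N : Multiset (Multiset ℕ)}
    (h : HasMeasures (fun a => a.toClause.rels) S N) :
    Acc (fun s s' => AlgStep s' s) (AlgState.phase1 S) := by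
  induction N using wellFounded_clauseLT.cutExpand.induction generalizing S with
  | _ N ih =>
    refine ⟨_, fun s hs => ?_⟩
    cases hs with
    | split1 S₁ S₂ S a Γ₁ Γ₂ φ x₁ x₂ y₁ y₂ ha hroot hφ hfresh hS =>
      obtain ⟨N', hN', hlt⟩ := h.replace (news := S) fun M hM b hb =>
        exists_hasMeasure_of_split1 ha hfresh hS hM hb
      exact ih N' hlt hN'
    | switch _ hS =>
      refine HasMeasures.acc_phase2 (N := N) ?_
      rw [HasMeasures, ← Multiset.map_coe, Multiset.rel_map_left]
      exact h

theorem acc_input {D : DNF α V} (hD : D.ChainFree) :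
    Acc (fun s s' => AlgStep s' s) (AlgState.input D) := by
  refine ⟨_, fun s hs => ?_⟩
  cases hs with
  | init _ S hS =>
    obtain ⟨N, hN⟩ := exists_hasMeasures (g := fun a : AnnClause α V => a.toClause.rels) (D := S)
      fun b hb => by
        obtain ⟨a, ha, hab⟩ := exists_of_forall₂_right hS b hb
        obtain ⟨C, hC, rfl⟩ := List.mem_map.1 ha
        obtain ⟨M, hM⟩ := graphChainFree_iff.1 (hD C hC)
        exact ⟨M, hab.hasMeasure (by simpa [toClause, ofClause] using hM)⟩
    exact hN.acc_phase1

/-! ### The final states -/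

/-- What is known about a state of a run on `D`: its formula is chain-free and satisfiable if and
only if `D` is, and nothing can be dropped from its reminders. -/
def Reached (D : DNF α V) : AlgState α V → Prop
  | .input D' => D' = D
  | .phase1 S => (∀ a ∈ S, (∃ M, HasMeasure a.toClause.rels M) ∧ a.Reduced) ∧
      (DNF.Satisfiable (S.map toClause) ↔ D.Satisfiable)
  | .phase2 D' => (∀ C ∈ D', ∃ M, HasMeasure C.rels M) ∧ (D'.Satisfiable ↔ D.Satisfiable)

theorem Reached.step {D : DNF α V} (hD : D.ChainFree) {s s' : AlgState α V} (hs : Reached D s)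
    (h : AlgStep s s') : Reached D s' := by
  cases h with
  | init D' S hS =>
    obtain rfl : D' = D := hs
    refine ⟨fun b hb => ?_, ?_⟩
    · obtain ⟨a, ha, hab⟩ := exists_of_forall₂_right hS b hb
      obtain ⟨C, hC, rfl⟩ := List.mem_map.1 ha
      obtain ⟨M, hM⟩ := graphChainFree_iff.1 (hD C hC)
      exact ⟨⟨M, hab.hasMeasure (by simpa [toClause, ofClause] using hM)⟩, hab.2⟩
    · refine exists_congr fun η => ?_
      simp only [List.mem_map, exists_exists_and_eq_and]
      rw [exists_holds_iff_of_forall₂ hS]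
      simp [toClause, ofClause]
  | split1 S₁ S₂ S a Γ₁ Γ₂ φ x₁ x₂ y₁ y₂ ha hroot hφ hfresh hS =>
    obtain ⟨hm, hsat⟩ := hs
    obtain ⟨⟨M, hM⟩, -⟩ := hm a (by simp)
    refine ⟨fun b hb => ?_, Iff.trans ?_ hsat⟩
    · simp only [List.mem_append] at hb
      rcases hb with (hb | hb) | hb
      · exact hm b (by simp [hb])
      · obtain ⟨M', hM', -⟩ := exists_hasMeasure_of_split1 ha hfresh hS hM hb
        obtain ⟨a', -, hab⟩ := exists_of_forall₂_right hS b hb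
        exact ⟨⟨M', hM'⟩, hab.2⟩
      · exact hm b (by simp [hb])
    · rw [satisfiable_map_iff, satisfiable_map_iff]
      refine exists_mem_replace_iff ?_
      have e : a.toClause = ⟨Γ₁ ++ φ :: (Γ₂ ++ a.dropped), a.side⟩ := by simp [toClause, ha]
      rw [e] at hfresh ⊢
      rw [satisfiable_split_iff hφ hfresh]
      have h' : (∃ b ∈ S, ∃ η, b.toClause.Holds η) ↔ ∃ η, ∃ b ∈ S, b.toClause.Holds η := by
        constructor
        · exact fun ⟨b, hb, η, h⟩ => ⟨η, b, hb, h⟩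
        · exact fun ⟨η, b, hb, h⟩ => ⟨b, hb, η, h⟩
      rw [h']
      simp only [exists_holds_iff_of_forall₂ hS, List.mem_map, exists_exists_and_eq_and,
        toClause_splitChild]
      exact ⟨fun ⟨c, hc, η, h⟩ => ⟨η, c, hc, h⟩, fun ⟨η, c, hc, h⟩ => ⟨c, hc, η, h⟩⟩
  | switch S hS =>
    refine ⟨fun C hC => ?_, hs.2⟩
    obtain ⟨a, ha, rfl⟩ := List.mem_map.1 hC
    exact (hs.1 a ha).1
  | split2 D₁ D₂ Γ₁ Γ₂ φ side x₁ x₂ y₁ y₂ hφ hfresh =>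
    obtain ⟨hm, hsat⟩ := hs
    obtain ⟨M, hM⟩ := hm ⟨Γ₁ ++ φ :: Γ₂, side⟩ (by simp)
    refine ⟨fun C hC => ?_, Iff.trans ?_ hsat⟩
    · simp only [List.mem_append] at hC
      rcases hC with (hC | hC) | hC
      · exact hm C (by simp [hC])
      · obtain ⟨c, hc, rfl⟩ := List.mem_map.1 hC
        obtain ⟨M', hM', -⟩ := hM.split hfresh hc
        exact ⟨M', hM'⟩
      · exact hm C (by simp [hC])
    · rw [← List.map_id (D₁ ++ _ ++ D₂), ← List.map_id (D₁ ++ _ :: D₂), satisfiable_map_iff,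
        satisfiable_map_iff]
      refine exists_mem_replace_iff ?_
      simp only [id]
      rw [satisfiable_split_iff hφ hfresh]
      simp only [List.mem_map, exists_exists_and_eq_and, SplitCase.child]

theorem Reached.of_run {D : DNF α V} (hD : D.ChainFree) {s : AlgState α V}
    (h : Relation.ReflTransGen AlgStep (.input D) s) : Reached D s := by
  induction h with
  | refl => exact rfl
  | tail _ h ih => exact ih.step hD h

/-- A run can be continued unless it is in the second phase with a concatenation-free formula. -/
theorem Reached.exists_eq_phase2 [Infinite V] {D : DNF α V} {s : AlgState α V} (hs : Reached D s)
    (hstuck : ∀ s', ¬ AlgStep s s') :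
    ∃ D' : DNF α V, s = .phase2 D' ∧ D'.ConcatFree := by
  cases s with
  | input D' =>
    obtain ⟨S, hS⟩ := exists_forall₂ exists_dropsTo (D'.map ofClause)
    exact (hstuck _ (.init D' S hS)).elim
  | phase1 S =>
    by_cases hcf : ∀ a ∈ S, a.ReminderConcatFree
    · exact (hstuck _ (.switch S hcf)).elim
    · push Not at hcf
      obtain ⟨a, ha, hna⟩ := hcf
      obtain ⟨⟨M, hM⟩, hred⟩ := hs.1 a ha
      obtain ⟨Γ₁, φ, Γ₂, hΓ, hroot, hφ⟩ := hred.exists_root hM hna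
      obtain ⟨x₁, x₂, y₁, y₂, hfresh⟩ := exists_freshFor a.toClause
      obtain ⟨S', hS'⟩ := exists_forall₂ exists_dropsTo
        ((φ.split x₁ x₂ y₁ y₂).map (a.splitChild Γ₁ Γ₂))
      obtain ⟨S₁, S₂, rfl⟩ := List.append_of_mem ha
      exact (hstuck _ (.split1 S₁ S₂ S' a Γ₁ Γ₂ φ x₁ x₂ y₁ y₂ hΓ hroot hφ hfresh hS')).elim
  | phase2 D' =>
    refine ⟨D', rfl, fun C hC φ hφ => ?_⟩
    by_contra hn
    obtain ⟨D₁, D₂, rfl⟩ := List.append_of_mem hC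
    obtain ⟨Γ, side⟩ := C
    obtain ⟨Γ₁, Γ₂, rfl⟩ := List.append_of_mem hφ
    obtain ⟨x₁, x₂, y₁, y₂, hfresh⟩ := exists_freshFor ⟨Γ₁ ++ φ :: Γ₂, side⟩
    exact hstuck _ (.split2 D₁ D₂ Γ₁ Γ₂ φ side x₁ x₂ y₁ y₂ hn hfresh)

end Algorithm

end StringConstraints

theorem mainTheorem2 {α : Type*} {V : Type*} [DecidableEq V] [Infinite V]
    (Ψ : StringConstraints.StringFormula α V) (hwf : Ψ.WellFormed) (hcf : Ψ.ChainFree) :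
    (¬ ∃ run : ℕ → StringConstraints.AlgState α V,
        run 0 = .input Ψ.dnf ∧ ∀ n, StringConstraints.AlgStep (run n) (run (n + 1))) ∧
    ∀ s : StringConstraints.AlgState α V,
      Relation.ReflTransGen StringConstraints.AlgStep (.input Ψ.dnf) s →
      (∀ s', ¬ StringConstraints.AlgStep s s') →
      ∃ D : StringConstraints.DNF α V, s = .phase2 D ∧
        (D.Satisfiable ↔ Ψ.Satisfiable) ∧ D.ChainFree ∧ D.ConcatFree := by
  constructor
  · rintro ⟨run, h₀, hstep⟩
    have key : ∀ s, Acc (fun s s' => StringConstraints.AlgStep s' s) s → ∀ n, run n ≠ s := by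
      intro s hs
      induction hs with
      | intro s _ ih =>
        rintro n rfl
        exact ih _ (hstep n) (n + 1) rfl
    exact key _ (StringConstraints.acc_input hcf) 0 h₀
  · intro s hrun hstuck
    have hs := StringConstraints.Reached.of_run hcf hrun
    obtain ⟨D, rfl, hD⟩ := hs.exists_eq_phase2 hstuck
    exact ⟨D, rfl, hs.2.trans (StringConstraints.StringFormula.satisfiable_dnf_iff hwf),
      fun C hC => StringConstraints.graphChainFree_iff.2 (hs.1 C hC), hD⟩
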